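/- Let $n\ge 0$ and $m_0,\dots,m_n\ge 1$ be integers, let $c_{k,l}\in\mathbb C$ and $\omega_{k,l}>-1$ be given for $0\le k\le n$, $1\le l\le m_k$, and let $b_0=0$ and $b_k>0$ for $1\le k\le n$. Put $\Omega=\max_{k,l}\omega_{k,l}$ and $\omega=\min_{k,l}\omega_{k,l}$. Let $A:\mathbb R\to\mathbb R$ be nonnegative and nondecreasing, with $A(x)=0$ for $x<1$, and suppose that the Mellin–Stieltjes transform $\mathcal A(s)=\int_{1^-}^{\infty}x^{-s}\,dA(x)$ converges for $\Re s>1$. For $\Re s>0$, $\sigma>0$ and $T>0$ define (with principal powers) $$G(s)=\frac{\mathcal A(s+1)}{s+1}-\sum_{k=0}^{n}\sum_{l=1}^{m_k}\left(\frac{c_{k,l}}{(s+ib_k)^{\omega_{k,l}+1}}+\frac{\overline{c_{k,l}}}{(s-ib_k)^{\omega_{k,l}+1}}\right),\qquad \eta(\sigma,T)=\int_{-T}^{T}\left|G(2\sigma+i\tau)-G(\sigma+i\tau)\right|d\tau .$$ Then there is a constant $C$, depending only on the numbers $c_{k,l}$, $b_k$ and $\Omega$, such that for all $T>0$ and all $x\ge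 \max(e^{16/15},e^{32/T})$ $$\left|A(x)-x\sum_{k=0}^{n}\sum_{l=1}^{m_k}\frac{(\log x)^{\omega_{k,l}}}{\Gamma(\omega_{k,l}+1)}\,2\,\Re\left(c_{k,l}e^{-ib_k\log x}\right)\right|\le C\,x\,\rho_T(x),$$ where $$\rho_T(x)=\left(\frac{e^{10/T}}{T}+1\right)\eta\left(\frac1{\log x},T\right)+\frac{e^{10/T}}{T}\log^{\Omega}x+\frac1{\log x}\left(\frac1{T^{\Omega+1}}+\frac1{T^{\omega+1}}\right).$$ Moreover, when $T\ge 1$, the same estimate holds (with a constant depending on the same quantities) with $$\rho_T(x)=\eta\left(\frac1{\log x},T\right)+\frac{\log^{\Omega}x}{T}+\frac{1}{T^{1+\omega}\log x}.$$ -/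

import Mathlib

open MeasureTheory

noncomputable section

namespace WienerIkehara

/-- The Lebesgue-Stieltjes measure `dA` of a nondecreasing function `A : ℝ → ℝ`. When `A` vanishes
on `(-∞, 1)`, its mass at the point `1` is the jump `A(1+) - A(1-) = A(1+)`. -/
def stieltjesMeasure (A : ℝ → ℝ) (hA : Monotone A) : Measure ℝ :=
  hA.stieltjesFunction.measure

/-- Convergence of `∫_1^∞ x^{-s} dA(x)` for all `s` with `Re s > 1`. As `dA` is a positive measure,
convergence at a real point `σ > 1` is absolute convergence on the whole line `Re s = σ`. -/
def MellinConverges (A : ℝ → ℝ) (hA : Monotone A) : Prop :=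
  ∀ s : ℂ, 1 < s.re →
    IntegrableOn (fun x : ℝ => (x : ℂ) ^ (-s)) (Set.Ici 1) (stieltjesMeasure A hA)

/-- The Mellin-Stieltjes transform `𝒜(s) = ∫_1^∞ x^{-s} dA(x)` (a mass at `x = 1` is included). -/
def mellinStieltjes (A : ℝ → ℝ) (hA : Monotone A) (s : ℂ) : ℂ :=
  ∫ x in Set.Ici (1 : ℝ), (x : ℂ) ^ (-s) ∂(stieltjesMeasure A hA)

/-- The singular part
`∑_k ∑_l ( c_{k,l} / (s + i b_k)^{ω_{k,l}+1} + conj c_{k,l} / (s - i b_k)^{ω_{k,l}+1} )`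
with principal powers (it is only used for `Re s > 0`). -/
def singularPart {n : ℕ} {m : Fin (n + 1) → ℕ} (c : (k : Fin (n + 1)) → Fin (m k) → ℂ)
    (b : Fin (n + 1) → ℝ) (ω : (k : Fin (n + 1)) → Fin (m k) → ℝ) (s : ℂ) : ℂ :=
  ∑ k, ∑ l, (c k l / (s + Complex.I * (b k : ℂ)) ^ ((ω k l : ℂ) + 1) +
    (starRingEnd ℂ) (c k l) / (s - Complex.I * (b k : ℂ)) ^ ((ω k l : ℂ) + 1))

/-- `G(s) = 𝒜(s+1)/(s+1) - (singular part)`. -/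
def G (A : ℝ → ℝ) (hA : Monotone A) {n : ℕ} {m : Fin (n + 1) → ℕ}
    (c : (k : Fin (n + 1)) → Fin (m k) → ℂ) (b : Fin (n + 1) → ℝ)
    (ω : (k : Fin (n + 1)) → Fin (m k) → ℝ) (s : ℂ) : ℂ :=
  1 / (s + 1) * mellinStieltjes A hA (s + 1) - singularPart c b ω s

/-- `η(σ, T) = ∫_{-T}^{T} |G(2σ + iτ) - G(σ + iτ)| dτ`. -/
def eta (A : ℝ → ℝ) (hA : Monotone A) {n : ℕ} {m : Fin (n + 1) → ℕ}
    (c : (k : Fin (n + 1)) → Fin (m k) → ℂ) (b : Fin (n + 1) → ℝ)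
    (ω : (k : Fin (n + 1)) → Fin (m k) → ℝ) (σ T : ℝ) : ℝ :=
  ∫ τ in (-T)..T,
    ‖G A hA c b ω (2 * (σ : ℂ) + Complex.I * (τ : ℂ)) -
      G A hA c b ω ((σ : ℂ) + Complex.I * (τ : ℂ))‖

/-- The main term divided by `x`:
`∑_k ∑_l (log x)^{ω_{k,l}} / Γ(ω_{k,l}+1) * 2 Re (c_{k,l} e^{-i b_k log x})`. -/
def mainTerm {n : ℕ} {m : Fin (n + 1) → ℕ} (c : (k : Fin (n + 1)) → Fin (m k) → ℂ)
    (b : Fin (n + 1) → ℝ) (ω : (k : Fin (n + 1)) → Fin (m k) → ℝ) (x : ℝ) : ℝ :=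
  ∑ k, ∑ l, Real.log x ^ ω k l / Real.Gamma (ω k l + 1) *
    (2 * (c k l * Complex.exp (-(Complex.I * (b k : ℂ) * (Real.log x : ℂ)))).re)

/-- The threshold `x₀(T) = max(e^{16/15}, e^{32/T})`. -/
def x₀ (T : ℝ) : ℝ := max (Real.exp (16 / 15)) (Real.exp (32 / T))

end WienerIkehara

end

/-! Put u = log x. The remainder r(u) = e^{-u} A(e^u) - (main term) has Laplace transform G on Re s
> 0, so r(u)(e^{-σu} - e^{-2σu}) is integrable with Fourier transform G(σ+iτ) - G(2σ+iτ), and η(σ,T)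
is the L¹ mass of that transform on [-T,T]. With σ = 1/log x the damping factor at u₀ = log x is the
fixed number e^{-1} - e^{-2}, so it suffices to bound the damped remainder at the single point u₀.

Write the damped remainder as F - N, with F from A and N from the main term. F is nonnegative and
F(u)e^{2u} is nondecreasing (`dampedCounting_slow`); N is O(u₀^Ω) everywhere, and Lipschitz at u₀
with a constant of the same order (`exists_dampedMain_bound`).

The Tauberian tool is a band-limited kernel k decaying quadratically. Both k² and y·k² have spectrum
in [-1,1], so integrals against them are bounded by the Fourier mass. Positivity of k² gives a crude
upper bound for F (`exists_crude_bound`). Testing instead with (y ± 1)k², which changes sign exactly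
at the point of interest, turns a one-sided Lipschitz condition into a two-sided bound there
(`exists_tauberian_bound`). Rescaling by T divides the Lipschitz constant by T, which yields log^Ω x
/ T (`exists_slow_bound`).

For T ≥ 1 this sharp bound gives both estimates; for T < 1 the crude bound already suffices. The
last summand of each ρ_T enters only through its sign. -/

noncomputable section

namespace WienerIkehara

/-! ### Trigonometric integrals and the Fourier mass on a window. -/

section

open Complex Set

/-- The trigonometric integral `∫_{-1/2}^{1/2} φ(τ) e^{-iτy} dτ`. -/
def trigIntegral (φ : ℝ → ℂ) (y : ℝ) : ℂ :=
  ∫ τ in (-(1 / 2) : ℝ)..(1 / 2), φ τ * cexp (-(I * τ * y))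

/-- The Fourier integral `∫ g(y) e^{-iθy} dy` of a real function. -/
def fourierInt (g : ℝ → ℝ) (θ : ℝ) : ℂ := ∫ y, (g y : ℂ) * cexp (-(I * θ * y))

/-- The integral of `|ĝ|` over `[-T, T]`. -/
def fourierMass (g : ℝ → ℝ) (T : ℝ) : ℝ := ∫ θ in (-T)..T, ‖fourierInt g θ‖

lemma norm_exp_neg_I_mul (a b : ℝ) : ‖cexp (-(I * a * b))‖ = 1 := by
  have : -(I * a * b) = ((-(a * b) : ℝ) : ℂ) * I := by push_cast; ring
  rw [this, norm_exp_ofReal_mul_I]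

lemma norm_trigIntegral_le {φ : ℝ → ℂ} {M : ℝ}
    (hφ : ∀ τ, |τ| ≤ 1 / 2 → ‖φ τ‖ ≤ M) (y : ℝ) : ‖trigIntegral φ y‖ ≤ M := by
  have := intervalIntegral.norm_integral_le_of_norm_le_const (a := (-(1 / 2) : ℝ)) (b := 1 / 2)
    (f := fun τ : ℝ => φ τ * cexp (-(I * τ * y))) (C := M) (fun τ hτ => by
      rw [uIoc_of_le (by norm_num)] at hτ
      rw [norm_mul, norm_exp_neg_I_mul, mul_one]
      exact hφ τ (abs_le.2 ⟨by linarith [hτ.1], hτ.2⟩))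
  norm_num at this ⊢
  exact this

lemma continuous_trigIntegral {φ : ℝ → ℂ} (hφ : Continuous φ) : Continuous (trigIntegral φ) := by
  unfold trigIntegral
  apply intervalIntegral.continuous_parametric_intervalIntegral_of_continuous'
  fun_prop

lemma norm_fourierInt_comp_add (g : ℝ → ℝ) (a θ : ℝ) :
    ‖fourierInt (fun y => g (y + a)) θ‖ = ‖fourierInt g θ‖ := by
  have h : fourierInt g θ = cexp (-(I * θ * a)) * fourierInt (fun y => g (y + a)) θ := by
    unfold fourierInt
    rw [← integral_const_mul, ← integral_add_right_eq_self _ a]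
    congr 1
    ext y
    rw [mul_left_comm, ← Complex.exp_add]
    congr 2
    push_cast
    ring
  rw [h, norm_mul, norm_exp_neg_I_mul, one_mul]

lemma fourierMass_comp_add (g : ℝ → ℝ) (a T : ℝ) :
    fourierMass (fun y => g (y + a)) T = fourierMass g T := by
  simp only [fourierMass, norm_fourierInt_comp_add]

lemma fourierMass_comp_div (g : ℝ → ℝ) {T : ℝ} (hT : 0 < T) :
    fourierMass (fun y => g (y / T)) 1 = fourierMass g T := by
  have h : ∀ θ, ‖fourierInt (fun y => g (y / T)) θ‖ = T * ‖fourierInt g (T * θ)‖ := by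
    intro θ
    have h1 := Measure.integral_comp_div (fun y : ℝ => (g y : ℂ) * cexp (-(I * (T * θ : ℝ) * y))) T
    have h2 : fourierInt (fun y => g (y / T)) θ
        = ∫ y : ℝ, (g (y / T) : ℂ) * cexp (-(I * (T * θ : ℝ) * (y / T : ℝ))) := by
      unfold fourierInt
      congr 1
      ext y
      congr 2
      have : (T : ℂ) ≠ 0 := ofReal_ne_zero.2 hT.ne'
      push_cast
      field_simp
    rw [h2, h1, norm_smul, Real.norm_eq_abs, abs_abs, abs_of_pos hT]
    rfl
  simp only [fourierMass, h]
  rw [intervalIntegral.integral_const_mul,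
    intervalIntegral.mul_integral_comp_mul_left (f := fun θ => ‖fourierInt g θ‖)]
  simp

lemma integrable_mul_exp {g : ℝ → ℂ} (hg : Integrable g) (θ : ℝ) :
    Integrable (fun y : ℝ => g y * cexp (-(I * θ * y))) := by
  refine hg.mul_bdd (c := 1) (by fun_prop) ?_
  exact Filter.Eventually.of_forall fun y => (norm_exp_neg_I_mul θ y).le

lemma continuous_fourierInt {g : ℝ → ℝ} (hg : Integrable g) : Continuous (fourierInt g) := by
  unfold fourierInt
  refine continuous_of_dominated (bound := fun y => ‖g y‖) ?_ ?_ hg.norm ?_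
  · intro θ
    exact (integrable_mul_exp hg.ofReal θ).aestronglyMeasurable
  · intro θ
    refine Filter.Eventually.of_forall fun y => ?_
    rw [norm_mul, norm_exp_neg_I_mul, mul_one, norm_real]
  · refine Filter.Eventually.of_forall fun y => ?_
    fun_prop

lemma integral_trigIntegral_mul {φ : ℝ → ℂ} (hφ : Continuous φ) {p : ℝ → ℂ} (hp : Integrable p) :
    ∫ y, trigIntegral φ y * p y =
      ∫ τ in (-(1 / 2) : ℝ)..(1 / 2), φ τ * ∫ y, p y * cexp (-(I * τ * y)) := by
  have hle : (-(1 / 2) : ℝ) ≤ 1 / 2 := by norm_num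
  simp only [trigIntegral, intervalIntegral.integral_of_le hle]
  have hφi : Integrable φ (volume.restrict (Ioc (-(1 / 2) : ℝ) (1 / 2))) :=
    (hφ.integrableOn_Icc).mono_set Ioc_subset_Icc_self
  have hint : Integrable (Function.uncurry fun (y τ : ℝ) => φ τ * cexp (-(I * τ * y)) * p y)
      (volume.prod (volume.restrict (Ioc (-(1 / 2) : ℝ) (1 / 2)))) := by
    have h := hp.mul_prod hφi
    have h2 := h.mul_bdd (c := 1) (g := fun z : ℝ × ℝ => cexp (-(I * z.2 * z.1)))
      (by fun_prop) (Filter.Eventually.of_forall fun z => (norm_exp_neg_I_mul z.2 z.1).le)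
    refine h2.congr (Filter.Eventually.of_forall fun z => ?_)
    simp only [Function.uncurry]
    ring
  simp only [← integral_mul_const, ← integral_const_mul]
  rw [integral_integral_swap hint]
  congr 1
  ext τ
  congr 1
  ext y
  ring

/-- A product of two trigonometric integrals has its spectrum in `[-1, 1]`. -/
lemma norm_integral_trigIntegral_mul_le {φ ψ : ℝ → ℂ} (hφ : Continuous φ) (hψ : Continuous ψ)
    {M₁ M₂ : ℝ} (h₁ : ∀ τ, |τ| ≤ 1 / 2 → ‖φ τ‖ ≤ M₁) (h₂ : ∀ τ, |τ| ≤ 1 / 2 → ‖ψ τ‖ ≤ M₂)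
    {g : ℝ → ℝ} (hg : Integrable g) :
    ‖∫ y, trigIntegral φ y * (trigIntegral ψ y * g y)‖ ≤ M₁ * (M₂ * fourierMass g 1) := by
  have hM₁ : 0 ≤ M₁ := (norm_nonneg _).trans (h₁ 0 (by norm_num))
  have hM₂ : 0 ≤ M₂ := (norm_nonneg _).trans (h₂ 0 (by norm_num))
  have hψg : Integrable (fun y => trigIntegral ψ y * (g y : ℂ)) :=
    hg.ofReal.bdd_mul (c := M₂) (continuous_trigIntegral hψ).aestronglyMeasurable
      (Filter.Eventually.of_forall fun y => norm_trigIntegral_le h₂ y)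
  have hc : Continuous fun θ => ‖fourierInt g θ‖ := (continuous_fourierInt hg).norm
  have hle : (-(1 / 2) : ℝ) ≤ 1 / 2 := by norm_num
  have inner : ∀ τ : ℝ, |τ| ≤ 1 / 2 →
      ‖∫ y, trigIntegral ψ y * (g y : ℂ) * cexp (-(I * τ * y))‖ ≤ M₂ * fourierMass g 1 := by
    -- Fubini a second time: multiplying g by e^{-iτy} shifts its transform, so the whole pairing
    -- becomes a double integral of φ(τ)ψ(σ)ĝ(σ+τ).
    intro τ hτ
    have e1 : ∫ y, trigIntegral ψ y * (g y : ℂ) * cexp (-(I * τ * y)) =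
        ∫ σ in (-(1 / 2) : ℝ)..(1 / 2), ψ σ * fourierInt g (σ + τ) := by
      have hgC : Integrable fun y => (g y : ℂ) := hg.ofReal
      have := integral_trigIntegral_mul hψ (integrable_mul_exp hgC τ)
      simp only [mul_assoc] at this ⊢
      rw [this]
      refine intervalIntegral.integral_congr fun σ _ => ?_
      simp only [fourierInt]
      congr 2
      ext y
      rw [← Complex.exp_add]
      congr 2
      push_cast
      ring
    rw [e1]
    calc ‖∫ σ in (-(1 / 2) : ℝ)..(1 / 2), ψ σ * fourierInt g (σ + τ)‖
        ≤ ∫ σ in (-(1 / 2) : ℝ)..(1 / 2), M₂ * ‖fourierInt g (σ + τ)‖ := by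
          refine intervalIntegral.norm_integral_le_of_norm_le hle
            (Filter.Eventually.of_forall fun σ hσ => ?_) ?_
          · rw [norm_mul]
            exact mul_le_mul_of_nonneg_right
              (h₂ σ (abs_le.2 ⟨by linarith [hσ.1], hσ.2⟩)) (norm_nonneg _)
          · exact (continuous_const.mul (hc.comp (by fun_prop))).intervalIntegrable _ _
      _ = M₂ * ∫ θ in (-(1 / 2) + τ)..(1 / 2 + τ), ‖fourierInt g θ‖ := by
          rw [intervalIntegral.integral_const_mul,
            intervalIntegral.integral_comp_add_right (fun θ => ‖fourierInt g θ‖)]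
      _ ≤ M₂ * fourierMass g 1 := by
          -- Since |τ| ≤ 1/2, the shifted window of length 1 stays inside [-1, 1].
          obtain ⟨ha, hb⟩ := abs_le.1 hτ
          refine mul_le_mul_of_nonneg_left ?_ hM₂
          refine intervalIntegral.integral_mono_interval (by linarith) (by linarith) (by linarith)
            (Filter.Eventually.of_forall fun θ => norm_nonneg _) (hc.intervalIntegrable _ _)
  rw [integral_trigIntegral_mul hφ hψg]
  have := intervalIntegral.norm_integral_le_of_norm_le_const (a := (-(1 / 2) : ℝ)) (b := 1 / 2)
    (f := fun τ : ℝ => φ τ * ∫ y, trigIntegral ψ y * (g y : ℂ) * cexp (-(I * τ * y)))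
    (C := M₁ * (M₂ * fourierMass g 1)) (fun τ hτ => by
      rw [uIoc_of_le (by norm_num)] at hτ
      have hτ' : |τ| ≤ 1 / 2 := abs_le.2 ⟨by linarith [hτ.1], hτ.2⟩
      rw [norm_mul]
      exact mul_le_mul (h₁ τ hτ') (inner τ hτ') (norm_nonneg _) hM₁)
  norm_num at this ⊢
  exact this

end

/-! ### The band-limited kernel and the two Tauberian estimates. -/

section

open Complex Set

lemma trigIntegral_conj (φ : ℝ → ℝ) (hφ : ∀ τ, φ (-τ) = φ τ) (y : ℝ) :
    (starRingEnd ℂ) (trigIntegral (fun τ => (φ τ : ℂ)) y) = trigIntegral (fun τ => (φ τ : ℂ)) y := by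
  have hle : (-(1 / 2) : ℝ) ≤ 1 / 2 := by norm_num
  have h := intervalIntegral.integral_comp_neg (a := (-(1 / 2) : ℝ)) (b := 1 / 2)
    (fun τ : ℝ => (φ τ : ℂ) * cexp (-(I * τ * y)))
  rw [neg_neg] at h
  unfold trigIntegral
  refine Eq.trans ?_ h
  rw [intervalIntegral.integral_of_le hle, intervalIntegral.integral_of_le hle, ← integral_conj]
  congr 1
  ext τ
  rw [map_mul, ← Complex.exp_conj]
  simp [hφ]

/-- The band-limited kernel `∫_{-1/2}^{1/2} (1/4 - τ²) cos(τy) dτ`. -/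
def kernel (y : ℝ) : ℝ := (trigIntegral (fun τ => ((1 / 4 - τ ^ 2 : ℝ) : ℂ)) y).re

lemma ofReal_kernel (y : ℝ) :
    (kernel y : ℂ) = trigIntegral (fun τ => ((1 / 4 - τ ^ 2 : ℝ) : ℂ)) y :=
  conj_eq_iff_re.1 (trigIntegral_conj (fun τ => 1 / 4 - τ ^ 2) (fun τ => by ring) y)

lemma continuous_kernel : Continuous kernel :=
  continuous_re.comp (continuous_trigIntegral (by fun_prop))

lemma kernel_neg (y : ℝ) : kernel (-y) = kernel y := by
  unfold kernel trigIntegral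
  have h := intervalIntegral.integral_comp_neg (a := (-(1 / 2) : ℝ)) (b := 1 / 2)
    (fun τ : ℝ => ((1 / 4 - τ ^ 2 : ℝ) : ℂ) * cexp (-(I * τ * y)))
  rw [neg_neg] at h
  rw [← h]
  congr 1
  refine intervalIntegral.integral_congr fun τ _ => ?_
  simp

lemma norm_kernel_symbol_le {τ : ℝ} (h : |τ| ≤ 1 / 2) : ‖((1 / 4 - τ ^ 2 : ℝ) : ℂ)‖ ≤ 1 / 4 := by
  rw [norm_real, Real.norm_eq_abs, abs_le]
  have := sq_abs τ
  constructor <;> nlinarith [abs_nonneg τ]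

lemma norm_kernel_symbol_deriv_le {τ : ℝ} (h : |τ| ≤ 1 / 2) : ‖2 * I * (τ : ℂ)‖ ≤ 1 := by
  simp only [norm_mul, norm_I, norm_real, Real.norm_eq_abs]
  norm_num
  linarith

lemma abs_kernel_le (y : ℝ) : |kernel y| ≤ 1 / 4 := by
  rw [← Real.norm_eq_abs, ← norm_real, ofReal_kernel]
  exact norm_trigIntegral_le (fun τ h => norm_kernel_symbol_le h) y

/-- Integration by parts; no boundary terms appear because 1/4 - τ² vanishes at ±1/2. This puts the
spectrum of y·k(y) in [-1/2, 1/2] as well, which is why this symbol is used instead of an indicator.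
-/
lemma mul_kernel (y : ℝ) :
    (y : ℂ) * kernel y = trigIntegral (fun τ => 2 * I * (τ : ℂ)) y := by
  have hd : ∀ τ : ℝ, HasDerivAt (fun τ : ℝ => I * (1 / 4 - (τ : ℂ) ^ 2) * cexp (-(I * τ * y)))
      (-(2 * I * τ * cexp (-(I * τ * y))) + y * ((1 / 4 - (τ : ℂ) ^ 2) * cexp (-(I * τ * y)))) τ := by
    intro τ
    have h1 : HasDerivAt (fun τ : ℂ => I * (1 / 4 - τ ^ 2) * cexp (-(I * τ * y)))
        (-(2 * I * τ * cexp (-(I * τ * y))) + y * ((1 / 4 - (τ : ℂ) ^ 2) * cexp (-(I * τ * y))))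
        (τ : ℂ) := by
      have e1 : HasDerivAt (fun τ : ℂ => I * (1 / 4 - τ ^ 2)) (I * (-(2 * τ))) (τ : ℂ) := by
        have := (((hasDerivAt_id (τ : ℂ)).pow 2).const_sub (1 / 4 : ℂ)).const_mul I
        simpa using this
      have e2 : HasDerivAt (fun τ : ℂ => cexp (-(I * τ * y)))
          (cexp (-(I * τ * y)) * (-(I * y))) (τ : ℂ) := by
        have := ((((hasDerivAt_id (τ : ℂ)).const_mul I).mul_const (y : ℂ)).neg).cexp
        simpa using this
      refine (e1.mul e2).congr_deriv ?_
      linear_combination -(y : ℂ) * (1 / 4 - (τ : ℂ) ^ 2) * cexp (-(I * τ * y)) * I_mul_I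
    exact h1.comp_ofReal
  have hint := intervalIntegral.integral_eq_sub_of_hasDerivAt (a := (-(1 / 2) : ℝ)) (b := 1 / 2)
    (fun τ _ => hd τ) (Continuous.intervalIntegrable (by fun_prop) _ _)
  rw [intervalIntegral.integral_add (Continuous.intervalIntegrable (by fun_prop) _ _)
    (Continuous.intervalIntegrable (by fun_prop) _ _), intervalIntegral.integral_neg,
    intervalIntegral.integral_const_mul] at hint
  rw [ofReal_kernel]
  unfold trigIntegral
  push_cast at hint ⊢
  norm_num at hint ⊢
  linear_combination hint

/-- A second integration by parts. The symbol 2iτ no longer vanishes at the endpoints: the two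
boundary terms contribute 1 each and the remaining integral at most 2. -/
lemma sq_mul_abs_kernel_le (y : ℝ) : y ^ 2 * |kernel y| ≤ 4 := by
  have hd : ∀ τ : ℝ, HasDerivAt (fun τ : ℝ => -2 * (τ : ℂ) * cexp (-(I * τ * y)))
      (y * (2 * I * τ * cexp (-(I * τ * y))) + (-2) * (1 * cexp (-(I * τ * y)))) τ := by
    intro τ
    have h1 : HasDerivAt (fun τ : ℂ => -2 * τ * cexp (-(I * τ * y)))
        (y * (2 * I * τ * cexp (-(I * τ * y))) + (-2) * (1 * cexp (-(I * τ * y)))) (τ : ℂ) := by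
      have e1 : HasDerivAt (fun τ : ℂ => -2 * τ) (-2) (τ : ℂ) := by
        simpa using (hasDerivAt_id (τ : ℂ)).const_mul (-2)
      have e2 : HasDerivAt (fun τ : ℂ => cexp (-(I * τ * y)))
          (cexp (-(I * τ * y)) * (-(I * y))) (τ : ℂ) := by
        have := ((((hasDerivAt_id (τ : ℂ)).const_mul I).mul_const (y : ℂ)).neg).cexp
        simpa using this
      refine (e1.mul e2).congr_deriv ?_
      ring
    exact h1.comp_ofReal
  have hint := intervalIntegral.integral_eq_sub_of_hasDerivAt (a := (-(1 / 2) : ℝ)) (b := 1 / 2)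
    (fun τ _ => hd τ) (Continuous.intervalIntegrable (by fun_prop) _ _)
  rw [intervalIntegral.integral_add (Continuous.intervalIntegrable (by fun_prop) _ _)
    (Continuous.intervalIntegrable (by fun_prop) _ _), intervalIntegral.integral_const_mul,
    intervalIntegral.integral_const_mul] at hint
  change y * trigIntegral (fun τ => 2 * I * (τ : ℂ)) y + (-2) * trigIntegral (fun _ => 1) y = _
    at hint
  rw [← mul_kernel] at hint
  have e : ((y ^ 2 * kernel y : ℝ) : ℂ) = 2 * trigIntegral (fun _ => 1) y
      + (-2 * ((1 / 2 : ℝ) : ℂ) * cexp (-(I * ((1 / 2 : ℝ) : ℂ) * y))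
        - -2 * ((-(1 / 2) : ℝ) : ℂ) * cexp (-(I * ((-(1 / 2) : ℝ) : ℂ) * y))) := by
    rw [← hint]
    push_cast
    ring
  have hn : y ^ 2 * |kernel y| = ‖((y ^ 2 * kernel y : ℝ) : ℂ)‖ := by
    rw [norm_real, Real.norm_eq_abs, abs_mul, abs_of_nonneg (sq_nonneg y)]
  rw [hn, e]
  have b1 : ‖2 * trigIntegral (fun _ => 1) y‖ ≤ 2 := by
    rw [norm_mul]
    have := norm_trigIntegral_le (φ := fun _ => 1) (M := 1) (fun _ _ => by simp) y
    norm_num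
    linarith
  have b2 : ‖-2 * ((1 / 2 : ℝ) : ℂ) * cexp (-(I * ((1 / 2 : ℝ) : ℂ) * y))‖ ≤ 1 := by
    rw [norm_mul, norm_exp_neg_I_mul]
    norm_num
  have b3 : ‖-2 * ((-(1 / 2) : ℝ) : ℂ) * cexp (-(I * ((-(1 / 2) : ℝ) : ℂ) * y))‖ ≤ 1 := by
    rw [norm_mul, norm_exp_neg_I_mul]
    norm_num
  calc _ ≤ _ := norm_add_le _ _
    _ ≤ 2 + (1 + 1) := add_le_add b1 ((norm_sub_le _ _).trans (add_le_add b2 b3))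
    _ = 4 := by norm_num

/-- The quartic decay of k² makes its second moment finite, as the quadratic lower bound in the
Tauberian estimate requires. -/
lemma one_add_sq_mul_kernel_sq_le (y : ℝ) :
    (1 + y ^ 2) * kernel y ^ 2 ≤ 25 * (1 + y ^ 2)⁻¹ := by
  have h : (1 + y ^ 2) * |kernel y| ≤ 5 := by
    linarith [sq_mul_abs_kernel_le y, abs_kernel_le y]
  have h2 : ((1 + y ^ 2) * |kernel y|) ^ 2 ≤ 5 ^ 2 := by gcongr
  rw [mul_pow, sq_abs] at h2
  have : 0 < 1 + y ^ 2 := by positivity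
  rw [← div_eq_mul_inv, le_div_iff₀ this]
  nlinarith

lemma integrable_one_add_sq_mul_kernel_sq : Integrable fun y => (1 + y ^ 2) * kernel y ^ 2 := by
  refine (integrable_inv_one_add_sq.const_mul 25).mono' ?_ ?_
  · have := continuous_kernel
    exact (by fun_prop : Continuous fun y => (1 + y ^ 2) * kernel y ^ 2).aestronglyMeasurable
  · refine Filter.Eventually.of_forall fun y => ?_
    rw [Real.norm_eq_abs, abs_of_nonneg (by positivity)]
    exact one_add_sq_mul_kernel_sq_le y

lemma integrable_mul_kernel_sq_of_le {q : ℝ → ℝ} (hq : Continuous q) {K : ℝ}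
    (h : ∀ y, |q y| ≤ K * (1 + y ^ 2)) : Integrable fun y => q y * kernel y ^ 2 := by
  refine (integrable_one_add_sq_mul_kernel_sq.const_mul K).mono' ?_ ?_
  · have := continuous_kernel
    exact (by fun_prop : Continuous fun y => q y * kernel y ^ 2).aestronglyMeasurable
  · refine Filter.Eventually.of_forall fun y => ?_
    rw [norm_mul, Real.norm_eq_abs, Real.norm_eq_abs, abs_of_nonneg (sq_nonneg (kernel y)),
      ← mul_assoc]
    exact mul_le_mul_of_nonneg_right (h y) (sq_nonneg _)

lemma integrable_kernel_sq : Integrable fun y => kernel y ^ 2 := by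
  have := integrable_mul_kernel_sq_of_le (q := fun _ => 1) continuous_const (K := 1)
    (fun y => by rw [abs_one]; nlinarith [sq_nonneg y])
  simpa using this

lemma integrable_mul_kernel_sq : Integrable fun y => y * kernel y ^ 2 :=
  integrable_mul_kernel_sq_of_le (q := fun y => y) continuous_id (K := 1)
    (fun y => by rw [abs_le]; constructor <;> nlinarith [sq_nonneg (y + 1), sq_nonneg (y - 1)])

lemma integral_mul_kernel_sq : ∫ y, y * kernel y ^ 2 = 0 := by
  have h := integral_neg_eq_self (fun y => y * kernel y ^ 2) volume
  simp only [kernel_neg, neg_mul, integral_neg] at h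
  linarith

/-- On this range |τy| ≤ 1/2, so cos(τy) ≥ 1/2, and the integral of 1/4 - τ² over the window is 1/6.
-/
lemma kernel_lower_bound {y : ℝ} (h0 : 0 ≤ y) (h1 : y ≤ 1) : 1 / 12 ≤ kernel y := by
  have e : kernel y = ∫ τ in (-(1 / 2) : ℝ)..(1 / 2), (1 / 4 - τ ^ 2) * Real.cos (τ * y) := by
    have hc : Continuous fun τ : ℝ => ((1 / 4 - τ ^ 2 : ℝ) : ℂ) * cexp (-(I * τ * y)) := by
      fun_prop
    unfold kernel trigIntegral
    have := intervalIntegral.intervalIntegral_re (𝕜 := ℂ) (hc.intervalIntegrable (μ := volume)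
      (-(1 / 2)) (1 / 2))
    change _ = (∫ τ in (-(1 / 2) : ℝ)..(1 / 2), ((1 / 4 - τ ^ 2 : ℝ) : ℂ) * cexp (-(I * τ * y))).re at this
    rw [← this]
    refine intervalIntegral.integral_congr fun τ _ => ?_
    have e2 : -(I * τ * y) = ((-(τ * y) : ℝ) : ℂ) * I := by push_cast; ring
    simp only [e2, RCLike.re_eq_complex_re, re_ofReal_mul, exp_ofReal_mul_I_re, Real.cos_neg]
  have e2 : ∫ τ in (-(1 / 2) : ℝ)..(1 / 2), (1 / 4 - τ ^ 2) * (1 / 2 : ℝ) = 1 / 12 := by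
    rw [intervalIntegral.integral_mul_const, intervalIntegral.integral_sub
      (Continuous.intervalIntegrable (by fun_prop) _ _)
      (Continuous.intervalIntegrable (by fun_prop) _ _)]
    simp only [integral_pow, intervalIntegral.integral_const, smul_eq_mul]
    norm_num
  rw [e, ← e2]
  refine intervalIntegral.integral_mono_on (by norm_num)
    (Continuous.intervalIntegrable (by fun_prop) _ _)
    (Continuous.intervalIntegrable (by fun_prop) _ _) fun τ hτ => ?_
  obtain ⟨ha, hb⟩ := hτ
  refine mul_le_mul_of_nonneg_left ?_ (by nlinarith)
  have hτ2 : τ ^ 2 ≤ 1 / 4 := by nlinarith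
  have hy2 : y ^ 2 ≤ 1 := by nlinarith
  have : (τ * y) ^ 2 ≤ 1 / 4 := by rw [mul_pow]; nlinarith [sq_nonneg τ, sq_nonneg y]
  linarith [Real.one_sub_sq_div_two_le_cos (x := τ * y)]

lemma integral_kernel_sq_pos : 0 < ∫ y, kernel y ^ 2 := by
  refine integral_pos_of_integrable_nonneg_nonzero (x := 0) (continuous_kernel.pow 2)
    integrable_kernel_sq (fun y => sq_nonneg _) ?_
  have := kernel_lower_bound (le_refl (0 : ℝ)) zero_le_one
  positivity

lemma abs_integral_kernel_sq_mul_le {g : ℝ → ℝ} (hg : Integrable g) :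
    |∫ y, kernel y ^ 2 * g y| ≤ fourierMass g 1 := by
  have h := norm_integral_trigIntegral_mul_le (φ := fun τ => ((1 / 4 - τ ^ 2 : ℝ) : ℂ))
    (ψ := fun τ => ((1 / 4 - τ ^ 2 : ℝ) : ℂ)) (by fun_prop) (by fun_prop) (M₁ := 1) (M₂ := 1)
    (fun τ h => (norm_kernel_symbol_le h).trans (by norm_num))
    (fun τ h => (norm_kernel_symbol_le h).trans (by norm_num)) hg
  simp only [← ofReal_kernel, ← ofReal_mul] at h
  rw [integral_complex_ofReal, norm_real, Real.norm_eq_abs, one_mul, one_mul] at h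
  simpa only [sq, mul_assoc] using h

lemma abs_integral_mul_kernel_sq_mul_le {g : ℝ → ℝ} (hg : Integrable g) :
    |∫ y, y * kernel y ^ 2 * g y| ≤ fourierMass g 1 := by
  have h := norm_integral_trigIntegral_mul_le (φ := fun τ => 2 * I * (τ : ℂ))
    (ψ := fun τ => ((1 / 4 - τ ^ 2 : ℝ) : ℂ)) (by fun_prop) (by fun_prop) (M₁ := 1) (M₂ := 1)
    (fun τ h => norm_kernel_symbol_deriv_le h)
    (fun τ h => (norm_kernel_symbol_le h).trans (by norm_num)) hg
  simp only [← ofReal_kernel, ← mul_kernel, ← ofReal_mul] at h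
  rw [integral_complex_ofReal, norm_real, Real.norm_eq_abs, one_mul, one_mul] at h
  simpa only [sq, mul_assoc] using h

lemma integrable_mul_kernel_sq_mul {q : ℝ → ℝ} (hq : Continuous q) {K : ℝ}
    (h : ∀ y, |q y| ≤ K * (1 + y ^ 2)) {g : ℝ → ℝ} (hg : Integrable g) :
    Integrable fun y => q y * kernel y ^ 2 * g y := by
  have := continuous_kernel
  have hK : 0 ≤ K := by simpa using (abs_nonneg _).trans (h 0)
  refine hg.bdd_mul (c := K * 25)
    (by fun_prop : Continuous fun y => q y * kernel y ^ 2).aestronglyMeasurable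
    (Filter.Eventually.of_forall fun y => ?_)
  rw [norm_mul, Real.norm_eq_abs, Real.norm_eq_abs, abs_of_nonneg (sq_nonneg (kernel y))]
  calc |q y| * kernel y ^ 2 ≤ K * (1 + y ^ 2) * kernel y ^ 2 :=
        mul_le_mul_of_nonneg_right (h y) (sq_nonneg _)
    _ = K * ((1 + y ^ 2) * kernel y ^ 2) := by ring
    _ ≤ K * 25 := by
        refine mul_le_mul_of_nonneg_left ((one_add_sq_mul_kernel_sq_le y).trans ?_) hK
        have : (1 + y ^ 2)⁻¹ ≤ 1 := inv_le_one_of_one_le₀ (by nlinarith [sq_nonneg y])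
        linarith

/-- Crude upper bound from the Fourier mass of a function bounded below. -/
lemma exists_crude_bound : ∃ C : ℝ, 0 ≤ C ∧ ∀ (g : ℝ → ℝ) (a B : ℝ), Integrable g → 0 ≤ a → 0 ≤ B →
    (∀ y, 0 ≤ g y + B) → (∀ y, 0 ≤ y → y ≤ 1 → a ≤ g y + B) →
    a ≤ C * (fourierMass g 1 + B) := by
  set S := ∫ y, kernel y ^ 2 with hS
  refine ⟨144 * (1 + S), by have := integral_kernel_sq_pos; positivity,
    fun g a B hg ha hB h0 h1 => ?_⟩
  have hS0 : 0 < S := integral_kernel_sq_pos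
  have hi1 : Integrable fun y => kernel y ^ 2 * g y := by
    simpa using integrable_mul_kernel_sq_mul (q := fun _ => 1) continuous_const (K := 1)
      (fun y => by rw [abs_one]; nlinarith [sq_nonneg y]) hg
  have hi2 : Integrable fun y => kernel y ^ 2 * B := integrable_kernel_sq.mul_const B
  have hint : Integrable fun y => kernel y ^ 2 * (g y + B) := by
    simp only [mul_add]
    exact hi1.add hi2
  have e : ∫ y, kernel y ^ 2 * (g y + B) = (∫ y, kernel y ^ 2 * g y) + S * B := by
    simp only [mul_add]
    rw [integral_add hi1 hi2, integral_mul_const]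
  have l1 : ∫ y in Icc (0 : ℝ) 1, (a / 144 : ℝ) ≤ ∫ y in Icc (0 : ℝ) 1, kernel y ^ 2 * (g y + B) := by
    refine setIntegral_mono_on (integrable_const _) hint.integrableOn measurableSet_Icc ?_
    intro y hy
    have k1 := kernel_lower_bound hy.1 hy.2
    have k2 : 1 / 144 ≤ kernel y ^ 2 := by nlinarith
    have := h1 y hy.1 hy.2
    calc a / 144 = 1 / 144 * a := by ring
      _ ≤ kernel y ^ 2 * (g y + B) := mul_le_mul k2 this ha (sq_nonneg _)
  have l2 : ∫ y in Icc (0 : ℝ) 1, kernel y ^ 2 * (g y + B) ≤ ∫ y, kernel y ^ 2 * (g y + B) :=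
    setIntegral_le_integral hint
      (Filter.Eventually.of_forall fun y => mul_nonneg (sq_nonneg _) (h0 y))
  have l3 := (abs_le.1 (abs_integral_kernel_sq_mul_le hg)).2
  simp at l1
  have hW : 0 ≤ fourierMass g 1 := (abs_nonneg _).trans (abs_integral_kernel_sq_mul_le hg)
  nlinarith [mul_nonneg hS0.le hW]

/-- One-sided Tauberian estimate: a function whose one-sided Lipschitz constant at `0` is `P` is
controlled at `0` by `P` and its Fourier mass. -/
lemma exists_tauberian_bound : ∃ C : ℝ, 0 ≤ C ∧ ∀ (g : ℝ → ℝ) (P : ℝ), Integrable g → 0 ≤ P →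
    (∀ v, -(P * v ^ 2) ≤ v * (g v - g 0)) → |g 0| ≤ C * (fourierMass g 1 + P) := by
  set S := ∫ y, kernel y ^ 2 with hS
  set D := ∫ y, (1 + y ^ 2) * kernel y ^ 2 with hD
  have hS0 : 0 < S := integral_kernel_sq_pos
  have hD0 : 0 ≤ D := integral_nonneg fun y => by positivity
  refine ⟨(2 + D) / S, by positivity, fun g P hg hP0 hP => ?_⟩
  -- The test function is (y+e)k(y)² at the point y+e, with e = ±1. Its sign is that of the
  -- displacement y+e from 0, so the hypothesis applies on both sides of 0; its integral is eS, so
  -- the two choices of e bound g(0) from above and from below.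
  have key : ∀ e : ℝ, e ^ 2 = 1 → e * g 0 * S ≤ 2 * fourierMass g 1 + P * D := by
    intro e he
    have hae : |e| = 1 := by rw [← sq_eq_sq₀ (abs_nonneg _) zero_le_one, sq_abs, he, one_pow]
    have hge : Integrable fun y => g (y + e) := hg.comp_add_right e
    have hW := fourierMass_comp_add g e 1
    have b1 := abs_integral_kernel_sq_mul_le hge
    have b2 := abs_integral_mul_kernel_sq_mul_le hge
    rw [hW] at b1 b2
    have i1 : Integrable fun y => kernel y ^ 2 * g (y + e) := by
      simpa using integrable_mul_kernel_sq_mul (q := fun _ => 1) continuous_const (K := 1)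
        (fun y => by rw [abs_one]; nlinarith [sq_nonneg y]) hge
    have i2 : Integrable fun y => y * kernel y ^ 2 * g (y + e) :=
      integrable_mul_kernel_sq_mul (q := fun y => y) continuous_id (K := 1)
        (fun y => by
          rw [abs_le]; constructor <;> nlinarith [sq_nonneg (y + 1), sq_nonneg (y - 1)]) hge
    have ea : ∀ y, (y + e) * (g (y + e) - g 0) * kernel y ^ 2 =
        (y * kernel y ^ 2 * g (y + e) + e * (kernel y ^ 2 * g (y + e))) -
          (g 0 * (y * kernel y ^ 2) + g 0 * e * kernel y ^ 2) := fun y => by ring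
    -- Here (y+e)² = 1 + y² + 2ey; the odd term integrates to zero, leaving P·D.
    have eb : ∀ y, -(P * (y + e) ^ 2) * kernel y ^ 2 =
        -(P * ((1 + y ^ 2) * kernel y ^ 2) + P * (2 * e) * (y * kernel y ^ 2)) := fun y => by
      linear_combination -P * kernel y ^ 2 * he
    have j1 : Integrable fun y => y * kernel y ^ 2 * g (y + e) + e * (kernel y ^ 2 * g (y + e)) :=
      i2.add (i1.const_mul e)
    have j2 : Integrable fun y => g 0 * (y * kernel y ^ 2) + g 0 * e * kernel y ^ 2 :=
      (integrable_mul_kernel_sq.const_mul (g 0)).add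
      (integrable_kernel_sq.const_mul (g 0 * e))
    have j3 : Integrable fun y => P * ((1 + y ^ 2) * kernel y ^ 2) + P * (2 * e) * (y * kernel y ^ 2) :=
      (integrable_one_add_sq_mul_kernel_sq.const_mul P).add
      (integrable_mul_kernel_sq.const_mul (P * (2 * e)))
    have hle : ∫ y, -(P * (y + e) ^ 2) * kernel y ^ 2 ≤
        ∫ y, (y + e) * (g (y + e) - g 0) * kernel y ^ 2 := by
      refine integral_mono ?_ ?_ fun y => mul_le_mul_of_nonneg_right (hP (y + e)) (sq_nonneg _)
      · simp only [eb]
        exact j3.neg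
      · simp only [ea]
        exact j1.sub j2
    simp only [ea, eb] at hle
    rw [integral_neg, integral_add (integrable_one_add_sq_mul_kernel_sq.const_mul P)
      (integrable_mul_kernel_sq.const_mul (P * (2 * e))), integral_sub j1 j2,
      integral_add i2 (i1.const_mul e), integral_add (integrable_mul_kernel_sq.const_mul (g 0))
      (integrable_kernel_sq.const_mul (g 0 * e))] at hle
    simp only [integral_const_mul, integral_mul_kernel_sq, mul_zero, add_zero, zero_add,
      ← hS, ← hD] at hle
    have b3 : e * ∫ y, kernel y ^ 2 * g (y + e) ≤ fourierMass g 1 := by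
      refine (le_abs_self _).trans ?_
      rw [abs_mul, hae, one_mul]
      exact b1
    linarith [(abs_le.1 b2).2]
  have hW : 0 ≤ fourierMass g 1 := (abs_nonneg _).trans (abs_integral_kernel_sq_mul_le hg)
  have k1 := key 1 (by norm_num)
  have k2 := key (-1) (by norm_num)
  have k3 : |g 0| * S ≤ 2 * fourierMass g 1 + P * D := by
    rw [← abs_of_pos hS0, ← abs_mul, abs_le]
    constructor <;> linarith
  rw [div_mul_eq_mul_div, le_div_iff₀ hS0]
  nlinarith [mul_nonneg hD0 hW]

end

/-! ### Bounds for the damped main term, uniform in the exponents. -/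

section

open Complex Set

/-- The profile `t^ω (e^{-t} - e^{-2t})`. -/
def profile (ω t : ℝ) : ℝ := t ^ ω * (Real.exp (-t) - Real.exp (-(2 * t)))

lemma exp_neg_sub_exp_neg_two_mul (t : ℝ) :
    Real.exp (-t) - Real.exp (-(2 * t)) = Real.exp (-t) * (1 - Real.exp (-t)) := by
  rw [mul_sub, mul_one, ← Real.exp_add]
  ring_nf

lemma exp_neg_sub_exp_neg_two_mul_nonneg {t : ℝ} (ht : 0 ≤ t) :
    0 ≤ Real.exp (-t) - Real.exp (-(2 * t)) := by
  rw [sub_nonneg, Real.exp_le_exp]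
  linarith

lemma profile_nonneg (ω : ℝ) {t : ℝ} (ht : 0 ≤ t) : 0 ≤ profile ω t :=
  mul_nonneg (Real.rpow_nonneg ht _) (exp_neg_sub_exp_neg_two_mul_nonneg ht)

/-- Near 0 the difference of exponentials supplies a factor t, and t^{ω+1} ≤ 1 since ω > -1; a
single exponential would leave t^ω unbounded for ω < 0. For t ≥ 1 the exponential beats t^⌈Ω⌉. -/
lemma exists_profile_le (Ω : ℝ) : ∃ K : ℝ, 0 ≤ K ∧ ∀ ω, -1 < ω → ω ≤ Ω → ∀ t, 0 < t →
    profile ω t ≤ K := by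
  set N := ⌈Ω⌉₊
  refine ⟨1 + N.factorial, by positivity, fun ω h1 h2 t ht => ?_⟩
  have hN : (0 : ℝ) ≤ N.factorial := by positivity
  rcases le_total t 1 with h | h
  · have e1 : Real.exp (-t) - Real.exp (-(2 * t)) ≤ t := by
      rw [exp_neg_sub_exp_neg_two_mul]
      have a1 : Real.exp (-t) ≤ 1 := Real.exp_le_one_iff.2 (by linarith)
      have a2 := Real.add_one_le_exp (-t)
      nlinarith [Real.exp_pos (-t)]
    calc profile ω t ≤ t ^ ω * t := mul_le_mul_of_nonneg_left e1 (Real.rpow_nonneg ht.le _)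
      _ = t ^ (ω + 1) := by rw [Real.rpow_add_one ht.ne']
      _ ≤ 1 := Real.rpow_le_one ht.le h (by linarith)
      _ ≤ _ := by linarith
  · have e1 : Real.exp (-t) - Real.exp (-(2 * t)) ≤ Real.exp (-t) := by
      linarith [Real.exp_pos (-(2 * t))]
    have e2 : t ^ ω ≤ t ^ N := by
      rw [← Real.rpow_natCast]
      exact Real.rpow_le_rpow_of_exponent_le h (h2.trans (Nat.le_ceil Ω))
    have e3 : t ^ N * Real.exp (-t) ≤ N.factorial := by
      rw [Real.exp_neg, ← div_eq_mul_inv, div_le_iff₀ (Real.exp_pos t)]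
      have := Real.pow_div_factorial_le_exp t ht.le N
      rwa [div_le_iff₀' (by positivity)] at this
    calc profile ω t ≤ t ^ N * Real.exp (-t) :=
          mul_le_mul e2 e1 (exp_neg_sub_exp_neg_two_mul_nonneg ht.le) (by positivity)
      _ ≤ _ := by linarith

lemma abs_exp_neg_sub_exp_neg_le {s t : ℝ} (hs : 0 ≤ s) (ht : 0 ≤ t) :
    |Real.exp (-s) - Real.exp (-t)| ≤ |s - t| := by
  wlog h : s ≤ t generalizing s t
  · rw [abs_sub_comm, abs_sub_comm s]
    exact this ht hs (le_of_not_ge h)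
  rw [abs_of_nonneg (by rw [sub_nonneg, Real.exp_le_exp]; linarith), abs_sub_comm,
    abs_of_nonneg (by linarith)]
  have e : Real.exp (-t) = Real.exp (-s) * Real.exp (-(t - s)) := by
    rw [← Real.exp_add]; ring_nf
  have a1 : Real.exp (-s) ≤ 1 := Real.exp_le_one_iff.2 (by linarith)
  have a2 := Real.add_one_le_exp (-(t - s))
  have a3 : Real.exp (-(t - s)) ≤ 1 := Real.exp_le_one_iff.2 (by linarith)
  rw [e]
  nlinarith [Real.exp_pos (-s)]

lemma abs_exp_sub_one_le_mul_exp (y : ℝ) : |Real.exp y - 1| ≤ |y| * Real.exp |y| := by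
  have h1 := Real.add_one_le_exp y
  have h2 := Real.add_one_le_exp (-y)
  have h3 : Real.exp y * Real.exp (-y) = 1 := by rw [← Real.exp_add]; simp
  rcases le_total 0 y with h | h
  · rw [abs_of_nonneg h, abs_of_nonneg (by linarith)]
    nlinarith [Real.exp_pos y]
  · have h4 : 1 ≤ Real.exp |y| := Real.one_le_exp (abs_nonneg y)
    have h5 : Real.exp y ≤ 1 := Real.exp_le_one_iff.2 h
    rw [abs_of_nonpos (by linarith : Real.exp y - 1 ≤ 0)]
    nlinarith [abs_of_nonpos h]

lemma abs_log_le_two_mul {t : ℝ} (ht : 1 / 2 ≤ t) : |Real.log t| ≤ 2 * |t - 1| := by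
  have h0 : 0 < t := by linarith
  have h1 := Real.log_le_sub_one_of_pos h0
  have h2 := Real.one_sub_inv_le_log_of_pos h0
  have h3 : |1 - t⁻¹| ≤ 2 * |t - 1| := by
    have : 1 - t⁻¹ = t⁻¹ * (t - 1) := by field_simp
    rw [this, abs_mul]
    refine mul_le_mul_of_nonneg_right ?_ (abs_nonneg _)
    rw [abs_of_pos (inv_pos.2 h0)]
    exact inv_le_of_inv_le₀ (by norm_num) (by linarith)
  rw [abs_le] at h3 ⊢
  constructor
  · linarith
  · linarith [le_abs_self (t - 1), abs_nonneg (t - 1)]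

/-- Only increments based at t = 1 are controlled, since the profile need not be Lipschitz near 0.
Away from 1 boundedness is enough; close to 1 the power is written as exp(ω log t). -/
lemma exists_abs_profile_sub_le (Ω : ℝ) : ∃ K : ℝ, 0 ≤ K ∧ ∀ ω, -1 < ω → ω ≤ Ω → ∀ t, 0 < t →
    |profile ω t - profile ω 1| ≤ K * |t - 1| := by
  obtain ⟨K, hK, hb⟩ := exists_profile_le Ω
  set W := 1 + |Ω|
  have hW : 0 ≤ W := by positivity
  refine ⟨2 * K + (2 * W * Real.exp W + 3), by positivity, fun ω h1 h2 t ht => ?_⟩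
  have hd : 0 ≤ |t - 1| := abs_nonneg _
  have hE : 0 ≤ 2 * W * Real.exp W + 3 := by positivity
  by_cases h : 1 / 2 ≤ |t - 1|
  · have a1 := hb ω h1 h2 t ht
    have a2 := hb ω h1 h2 1 one_pos
    have a3 := profile_nonneg ω ht.le
    have a4 := profile_nonneg ω zero_le_one
    have : |profile ω t - profile ω 1| ≤ K := by rw [abs_le]; constructor <;> linarith
    nlinarith
  · push Not at h
    have ht2 : 1 / 2 ≤ t := by linarith [(abs_lt.1 h).1]
    have hω : |ω| ≤ W := by
      rw [abs_le]
      exact ⟨by linarith [abs_nonneg Ω], by linarith [le_abs_self Ω]⟩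
    have hl := abs_log_le_two_mul ht2
    have hp : |t ^ ω - 1| ≤ 2 * W * Real.exp W * |t - 1| := by
      rw [Real.rpow_def_of_pos ht]
      refine (abs_exp_sub_one_le_mul_exp _).trans ?_
      have b1 : |Real.log t * ω| ≤ 2 * |t - 1| * W := by
        rw [abs_mul]
        exact mul_le_mul hl hω (abs_nonneg _) (by positivity)
      have b2 : |Real.log t * ω| ≤ W := by nlinarith
      calc |Real.log t * ω| * Real.exp |Real.log t * ω| ≤ (2 * |t - 1| * W) * Real.exp W :=
            mul_le_mul b1 (Real.exp_le_exp.2 b2) (Real.exp_pos _).le (by positivity)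
        _ = _ := by ring
    set E := Real.exp (-t) - Real.exp (-(2 * t)) with hEdef
    have hE0 : 0 ≤ E := exp_neg_sub_exp_neg_two_mul_nonneg ht.le
    have hE1 : E ≤ 1 := by
      have a1 : Real.exp (-t) ≤ 1 := Real.exp_le_one_iff.2 (by linarith)
      linarith [Real.exp_pos (-(2 * t))]
    have c1 := abs_exp_neg_sub_exp_neg_le ht.le zero_le_one
    have c2 := abs_exp_neg_sub_exp_neg_le (s := 2 * t) (t := 2 * 1) (by linarith) (by norm_num)
    have c3 : |2 * t - 2 * 1| = 2 * |t - 1| := by rw [← mul_sub, abs_mul, abs_two]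
    rw [c3] at c2
    have e : profile ω t - profile ω 1 = (t ^ ω - 1) * E +
        ((Real.exp (-t) - Real.exp (-1)) - (Real.exp (-(2 * t)) - Real.exp (-(2 * 1)))) := by
      simp only [profile, Real.one_rpow, hEdef]
      ring
    have d1 : |(t ^ ω - 1) * E| ≤ 2 * W * Real.exp W * |t - 1| := by
      rw [abs_mul, abs_of_nonneg hE0]
      exact (mul_le_of_le_one_right (abs_nonneg _) hE1).trans hp
    rw [e]
    calc _ ≤ _ := abs_add_le _ _
      _ ≤ 2 * W * Real.exp W * |t - 1| + (|t - 1| + 2 * |t - 1|) :=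
          add_le_add d1 ((abs_sub _ _).trans (add_le_add c1 c2))
      _ ≤ _ := by nlinarith

/-- 1/Γ is entire, hence bounded on the compact interval [0, Ω+1]; this gives uniformity as ω
approaches -1. -/
lemma exists_inv_Gamma_le (Ω : ℝ) : ∃ K : ℝ, 0 ≤ K ∧ ∀ ω, -1 < ω → ω ≤ Ω →
    (Real.Gamma (ω + 1))⁻¹ ≤ K := by
  have hc : Continuous fun x : ℝ => ‖(Complex.Gamma (x : ℂ))⁻¹‖ :=
    (Complex.differentiable_one_div_Gamma.continuous.comp continuous_ofReal).norm
  obtain ⟨K, hK⟩ := (isCompact_Icc (a := (0 : ℝ)) (b := Ω + 1)).bddAbove_image hc.continuousOn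
  refine ⟨max K 0, le_max_right _ _, fun ω h1 h2 => ?_⟩
  have := hK ⟨ω + 1, ⟨by linarith, by linarith⟩, rfl⟩
  simp only [Complex.Gamma_ofReal, ← ofReal_inv, norm_real, Real.norm_eq_abs] at this
  exact ((le_abs_self _).trans this).trans (le_max_left _ _)

/-- The damping factor `e^{-σu} - e^{-2σu}`. -/
def damping (σ u : ℝ) : ℝ := Real.exp (-(σ * u)) - Real.exp (-(2 * (σ * u)))

/-- The contribution of one singularity to the main term, damped. -/
def dampedTerm (c : ℂ) (b ω σ u : ℝ) : ℝ :=
  u ^ ω / Real.Gamma (ω + 1) * (2 * (c * cexp (-(I * (b : ℂ) * (u : ℂ)))).re) * damping σ u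

/-- The main term multiplied by the damping factor, extended by zero to the negative axis. -/
def dampedMain {n : ℕ} {m : Fin (n + 1) → ℕ} (c : (k : Fin (n + 1)) → Fin (m k) → ℂ)
    (b : Fin (n + 1) → ℝ) (ω : (k : Fin (n + 1)) → Fin (m k) → ℝ) (σ : ℝ) : ℝ → ℝ :=
  (Ioi 0).indicator fun u => ∑ k, ∑ l, dampedTerm (c k l) (b k) (ω k l) σ u

lemma abs_re_oscillation_le (c : ℂ) (b u : ℝ) : |(c * cexp (-(I * (b : ℂ) * (u : ℂ)))).re| ≤ ‖c‖ := by
  refine (abs_re_le_norm _).trans ?_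
  rw [norm_mul, norm_exp_neg_I_mul, mul_one]

lemma abs_re_oscillation_sub_le (c : ℂ) (b u v : ℝ) :
    |(c * cexp (-(I * (b : ℂ) * (u : ℂ)))).re - (c * cexp (-(I * (b : ℂ) * (v : ℂ)))).re| ≤
      ‖c‖ * (|b| * |u - v|) := by
  rw [← sub_re]
  refine (abs_re_le_norm _).trans ?_
  have e : c * cexp (-(I * (b : ℂ) * (u : ℂ))) - c * cexp (-(I * (b : ℂ) * (v : ℂ))) =
      c * (cexp (-(I * (b : ℂ) * (v : ℂ))) * (cexp (I * ((-(b * (u - v)) : ℝ) : ℂ)) - 1)) := by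
    rw [← mul_sub, mul_sub (cexp _), ← Complex.exp_add, mul_one]
    congr 3
    push_cast
    ring_nf
  rw [e, norm_mul, norm_mul, norm_exp_neg_I_mul, one_mul]
  refine mul_le_mul_of_nonneg_left ?_ (norm_nonneg _)
  refine (Real.norm_exp_I_mul_ofReal_sub_one_le).trans ?_
  rw [Real.norm_eq_abs, abs_neg, abs_mul]

/-- Scaling u = u₀t turns the damped power into u₀^ω times the profile at t. As u₀ ≥ 1, u₀^ω ≤ u₀^Ω
and |t - 1| ≤ |u - u₀|; the oscillating factor adds |b| to the Lipschitz constant. -/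
lemma exists_dampedTerm_bound (Ω : ℝ) : ∃ K : ℝ, 0 ≤ K ∧ ∀ (c : ℂ) (b ω : ℝ), -1 < ω → ω ≤ Ω →
    ∀ u₀ u : ℝ, 1 ≤ u₀ → 0 < u →
      |dampedTerm c b ω (1 / u₀) u| ≤ K * (‖c‖ * (1 + |b|)) * u₀ ^ Ω ∧
      |dampedTerm c b ω (1 / u₀) u - dampedTerm c b ω (1 / u₀) u₀| ≤
        K * (‖c‖ * (1 + |b|)) * u₀ ^ Ω * |u - u₀| := by
  obtain ⟨K₁, hK₁, hb₁⟩ := exists_profile_le Ω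
  obtain ⟨K₂, hK₂, hb₂⟩ := exists_abs_profile_sub_le Ω
  obtain ⟨K₃, hK₃, hb₃⟩ := exists_inv_Gamma_le Ω
  refine ⟨2 * K₃ * (K₁ + K₂), by positivity, fun c b ω h1 h2 u₀ u hu₀ hu => ?_⟩
  have hu₀' : 0 < u₀ := by linarith
  have e : ∀ v, 0 < v → dampedTerm c b ω (1 / u₀) v = u₀ ^ ω * (Real.Gamma (ω + 1))⁻¹ * 2 *
      (profile ω (v / u₀) * (c * cexp (-(I * (b : ℂ) * (v : ℂ)))).re) := by
    intro v hv
    have : 1 / u₀ * v = v / u₀ := by ring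
    simp only [dampedTerm, damping, profile, this]
    rw [Real.div_rpow hv.le hu₀'.le]
    have := (Real.rpow_pos_of_pos hu₀' ω).ne'
    field_simp
  have hG : 0 < (Real.Gamma (ω + 1))⁻¹ := inv_pos.2 (Real.Gamma_pos_of_pos (by linarith))
  have hA : u₀ ^ ω * (Real.Gamma (ω + 1))⁻¹ * 2 ≤ u₀ ^ Ω * K₃ * 2 := by
    have := Real.rpow_le_rpow_of_exponent_le hu₀ h2
    have := hb₃ ω h1 h2
    gcongr
  have hA0 : 0 ≤ u₀ ^ ω * (Real.Gamma (ω + 1))⁻¹ * 2 := by positivity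
  have hU : 0 ≤ u₀ ^ Ω := by positivity
  have pb : ∀ v, 0 < v → |profile ω (v / u₀)| ≤ K₁ := fun v hv => by
    rw [abs_of_nonneg (profile_nonneg _ (by positivity))]
    exact hb₁ ω h1 h2 _ (by positivity)
  constructor
  · rw [e u hu, abs_mul, abs_of_nonneg hA0]
    calc _ ≤ (u₀ ^ Ω * K₃ * 2) * (K₁ * ‖c‖) := by
          refine mul_le_mul hA ?_ (abs_nonneg _) (by positivity)
          rw [abs_mul]
          exact mul_le_mul (pb u hu) (abs_re_oscillation_le c b u) (abs_nonneg _) hK₁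
      _ = 2 * K₃ * K₁ * (‖c‖ * 1) * u₀ ^ Ω := by ring
      _ ≤ _ := by
          gcongr
          · linarith
          · linarith [abs_nonneg b]
  · rw [e u hu, e u₀ hu₀', div_self hu₀'.ne', ← mul_sub, abs_mul, abs_of_nonneg hA0]
    set r := (c * cexp (-(I * (b : ℂ) * (u : ℂ)))).re
    set r₀ := (c * cexp (-(I * (b : ℂ) * (u₀ : ℂ)))).re
    have p1 : |profile ω 1| ≤ K₁ := by
      rw [abs_of_nonneg (profile_nonneg _ zero_le_one)]
      exact hb₁ ω h1 h2 _ one_pos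
    have p2 : |profile ω (u / u₀) - profile ω 1| ≤ K₂ * |u - u₀| := by
      refine (hb₂ ω h1 h2 _ (by positivity)).trans (mul_le_mul_of_nonneg_left ?_ hK₂)
      have : u / u₀ - 1 = (u - u₀) / u₀ := by field_simp
      rw [this, abs_div, abs_of_pos hu₀']
      exact div_le_self (abs_nonneg _) hu₀
    have q1 : |r| ≤ ‖c‖ := abs_re_oscillation_le c b u
    have q2 : |r - r₀| ≤ ‖c‖ * (|b| * |u - u₀|) := abs_re_oscillation_sub_le c b u u₀
    have key : |profile ω (u / u₀) * r - profile ω 1 * r₀| ≤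
        K₂ * |u - u₀| * ‖c‖ + K₁ * (‖c‖ * (|b| * |u - u₀|)) := by
      have : profile ω (u / u₀) * r - profile ω 1 * r₀ =
        (profile ω (u / u₀) - profile ω 1) * r + profile ω 1 * (r - r₀) := by ring
      rw [this]
      refine (abs_add_le _ _).trans ?_
      rw [abs_mul, abs_mul]
      gcongr
    calc _ ≤ (u₀ ^ Ω * K₃ * 2) * (K₂ * |u - u₀| * ‖c‖ + K₁ * (‖c‖ * (|b| * |u - u₀|))) :=
          mul_le_mul hA key (abs_nonneg _) (by positivity)
      _ = 2 * K₃ * ((K₂ * 1 + K₁ * |b|) * ‖c‖) * u₀ ^ Ω * |u - u₀| := by ring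
      _ ≤ 2 * K₃ * (((K₁ + K₂) * 1 + (K₁ + K₂) * |b|) * ‖c‖) * u₀ ^ Ω * |u - u₀| := by
          gcongr <;> linarith
      _ = _ := by ring

lemma exists_dampedMain_bound {n : ℕ} {m : Fin (n + 1) → ℕ}
    (c : (k : Fin (n + 1)) → Fin (m k) → ℂ) (b : Fin (n + 1) → ℝ) (Ω : ℝ) :
    ∃ K : ℝ, 0 ≤ K ∧ ∀ ω : (k : Fin (n + 1)) → Fin (m k) → ℝ, (∀ k l, -1 < ω k l) →
      (∀ k l, ω k l ≤ Ω) → ∀ u₀ u : ℝ, 1 ≤ u₀ →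
        |dampedMain c b ω (1 / u₀) u| ≤ K * u₀ ^ Ω ∧
        |dampedMain c b ω (1 / u₀) u - dampedMain c b ω (1 / u₀) u₀| ≤ K * u₀ ^ Ω * |u - u₀| := by
  obtain ⟨K, hK, hb⟩ := exists_dampedTerm_bound Ω
  refine ⟨∑ k, ∑ l, K * (‖c k l‖ * (1 + |b k|)), by positivity, fun ω h1 h2 u₀ u hu₀ => ?_⟩
  have hu₀' : 0 < u₀ := by linarith
  have bound : ∀ v, 0 < v → |dampedMain c b ω (1 / u₀) v| ≤
      (∑ k, ∑ l, K * (‖c k l‖ * (1 + |b k|))) * u₀ ^ Ω := by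
    intro v hv
    rw [dampedMain, indicator_of_mem (mem_Ioi.2 hv), Finset.sum_mul]
    refine (Finset.abs_sum_le_sum_abs _ _).trans (Finset.sum_le_sum fun k _ => ?_)
    rw [Finset.sum_mul]
    refine (Finset.abs_sum_le_sum_abs _ _).trans (Finset.sum_le_sum fun l _ => ?_)
    exact (hb _ _ _ (h1 k l) (h2 k l) u₀ v hu₀ hv).1
  have hnn : 0 ≤ (∑ k, ∑ l, K * (‖c k l‖ * (1 + |b k|))) * u₀ ^ Ω := by positivity
  rcases lt_or_ge 0 u with hu | hu
  · refine ⟨bound u hu, ?_⟩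
    simp only [dampedMain]
    rw [indicator_of_mem (mem_Ioi.2 hu), indicator_of_mem (mem_Ioi.2 hu₀'),
      ← Finset.sum_sub_distrib, Finset.sum_mul, Finset.sum_mul]
    refine (Finset.abs_sum_le_sum_abs _ _).trans (Finset.sum_le_sum fun k _ => ?_)
    rw [← Finset.sum_sub_distrib, Finset.sum_mul, Finset.sum_mul]
    refine (Finset.abs_sum_le_sum_abs _ _).trans (Finset.sum_le_sum fun l _ => ?_)
    exact (hb _ _ _ (h1 k l) (h2 k l) u₀ u hu₀ hu).2
  -- The cut-off at 0 is harmless: for u ≤ 0 one has |u - u₀| ≥ u₀ ≥ 1, so the sup bound at u₀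
  -- serves as a Lipschitz bound.
  · have h0 : dampedMain c b ω (1 / u₀) u = 0 :=
      indicator_of_notMem (by simpa using hu) _
    rw [h0, abs_zero, zero_sub, abs_neg]
    refine ⟨hnn, (bound u₀ hu₀').trans ?_⟩
    refine le_mul_of_one_le_right hnn ?_
    rw [abs_sub_comm, abs_of_nonneg (by linarith)]
    linarith

end

/-! ### Laplace transform of the main term. -/

section

open Complex Set

/-- One singularity of the main term, without damping. -/
def pureTerm (c : ℂ) (b ω u : ℝ) : ℝ :=
  u ^ ω / Real.Gamma (ω + 1) * (2 * (c * cexp (-(I * (b : ℂ) * (u : ℂ)))).re)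

/-- The Laplace transform of a power on the real axis. -/
lemma laplace_rpow_real {ω : ℝ} (hω : -1 < ω) {s : ℝ} (hs : 0 < s) :
    ∫ u in Ioi (0 : ℝ), ((u ^ ω / Real.Gamma (ω + 1) : ℝ) : ℂ) * cexp (-(s * u)) =
      1 / (s : ℂ) ^ ((ω : ℂ) + 1) := by
  have hG : 0 < Real.Gamma (ω + 1) := Real.Gamma_pos_of_pos (by linarith)
  have hGC : Complex.Gamma ((ω : ℂ) + 1) = (Real.Gamma (ω + 1) : ℂ) := by
    rw [← Complex.Gamma_ofReal]; push_cast; rfl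
  have hG0 : (Real.Gamma (ω + 1) : ℂ) ≠ 0 := ofReal_ne_zero.2 hG.ne'
  have h := Complex.integral_cpow_mul_exp_neg_mul_Ioi (a := (ω : ℂ) + 1) (r := s)
    (by simp; linarith) hs
  have e1 : ∫ u in Ioi (0 : ℝ), ((u ^ ω / Real.Gamma (ω + 1) : ℝ) : ℂ) * cexp (-(s * u)) =
      (Real.Gamma (ω + 1) : ℂ)⁻¹ * ∫ u in Ioi (0 : ℝ),
        (u : ℂ) ^ ((ω : ℂ) + 1 - 1) * cexp (-(s * u)) := by
    rw [← integral_const_mul]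
    refine setIntegral_congr_fun measurableSet_Ioi fun u hu => ?_
    simp only [add_sub_cancel_right]
    rw [ofReal_div, ofReal_cpow (le_of_lt hu)]
    ring
  rw [e1, h, hGC, one_div, Complex.inv_cpow]
  · field_simp
  · rw [arg_ofReal_of_nonneg hs.le]
    exact Real.pi_pos.ne

/-- The gamma-type measure `u^ω / Γ(ω+1) du` on the positive axis. -/
def powerMeasure (ω : ℝ) : Measure ℝ :=
  (volume.restrict (Ioi 0)).withDensity fun u => ENNReal.ofReal (u ^ ω / Real.Gamma (ω + 1))

lemma integral_powerMeasure {ω : ℝ} (hω : -1 < ω) (f : ℝ → ℂ) :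
    ∫ u, f u ∂powerMeasure ω =
      ∫ u in Ioi (0 : ℝ), ((u ^ ω / Real.Gamma (ω + 1) : ℝ) : ℂ) * f u := by
  have hG : 0 < Real.Gamma (ω + 1) := Real.Gamma_pos_of_pos (by linarith)
  rw [powerMeasure, integral_withDensity_eq_integral_toReal_smul (by fun_prop)
    (Filter.Eventually.of_forall fun _ => ENNReal.ofReal_lt_top)]
  refine setIntegral_congr_fun measurableSet_Ioi fun u hu => ?_
  have : 0 ≤ u ^ ω / Real.Gamma (ω + 1) := div_nonneg (Real.rpow_nonneg (le_of_lt hu) _) hG.le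
  simp only [ENNReal.toReal_ofReal this, real_smul]

-- Both sides are analytic in the half-plane, the left as a complex moment generating function, and
-- they agree on the real axis; the identity theorem extends the Gamma integral to complex s.
open ProbabilityTheory in
lemma laplace_rpow {ω : ℝ} (hω : -1 < ω) {s : ℂ} (hs : 0 < s.re) :
    IntegrableOn (fun u : ℝ => ((u ^ ω / Real.Gamma (ω + 1) : ℝ) : ℂ) * cexp (-(s * u))) (Ioi 0) ∧
    ∫ u in Ioi (0 : ℝ), ((u ^ ω / Real.Gamma (ω + 1) : ℝ) : ℂ) * cexp (-(s * u)) =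
      1 / s ^ ((ω : ℂ) + 1) := by
  have hmgf : ∀ z : ℂ, complexMGF id (powerMeasure ω) z =
      ∫ u in Ioi (0 : ℝ), ((u ^ ω / Real.Gamma (ω + 1) : ℝ) : ℂ) * cexp (-(-z * u)) := by
    intro z
    rw [complexMGF, integral_powerMeasure hω]
    simp
  have hreal : ∀ x : ℝ, x < 0 → complexMGF id (powerMeasure ω) x = 1 / (-(x : ℂ)) ^ ((ω : ℂ) + 1) := by
    intro x hx
    have := laplace_rpow_real hω (neg_pos.2 hx)
    rw [hmgf]
    push_cast at this ⊢
    exact this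
  have hne : ∀ z : ℂ, z.re < 0 → (-z) ^ ((ω : ℂ) + 1) ≠ 0 := by
    intro z hz
    have : z ≠ 0 := by rintro rfl; simp at hz
    simp [cpow_eq_zero_iff, this]
  have hset : Iio (0 : ℝ) ⊆ interior (integrableExpSet id (powerMeasure ω)) := by
    refine interior_maximal (fun x hx => ?_) isOpen_Iio
    -- A Bochner integral is 0 by convention when the integrand is not integrable, so a nonzero
    -- value proves integrability. The same device closes the proof.
    have h1 : ∫ u, cexp (x * u) ∂powerMeasure ω ≠ 0 := by
      have := hreal x hx
      simp only [complexMGF, id_eq] at this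
      rw [this]
      exact one_div_ne_zero (hne x (by simpa using hx))
    have h2 := (Integrable.of_integral_ne_zero h1).norm
    refine h2.congr (Filter.Eventually.of_forall fun u => ?_)
    simp [Complex.norm_exp]
  have hopen : IsOpen {z : ℂ | z.re < 0} := isOpen_lt continuous_re continuous_const
  have han1 : AnalyticOnNhd ℂ (complexMGF id (powerMeasure ω)) {z : ℂ | z.re < 0} :=
    analyticOnNhd_complexMGF.mono fun z hz => hset hz
  have han2 : AnalyticOnNhd ℂ (fun z : ℂ => 1 / (-z) ^ ((ω : ℂ) + 1)) {z : ℂ | z.re < 0} := by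
    refine DifferentiableOn.analyticOnNhd (fun z hz => ?_) hopen
    refine DifferentiableAt.differentiableWithinAt ?_
    refine (differentiableAt_const _).div ?_ (hne z hz)
    refine differentiableAt_id.neg.cpow (differentiableAt_const _) ?_
    left
    simpa using hz
  have hconn : IsPreconnected {z : ℂ | z.re < 0} := (convex_halfSpace_re_lt 0).isPreconnected
  have htend : Filter.Tendsto (fun x : ℝ => (x : ℂ)) (nhdsWithin (-1) {-1}ᶜ)
      (nhdsWithin ((-1 : ℝ) : ℂ) {((-1 : ℝ) : ℂ)}ᶜ) := by
    refine tendsto_nhdsWithin_of_tendsto_nhds_of_eventually_within _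
      ((continuous_ofReal.tendsto _).mono_left nhdsWithin_le_nhds) ?_
    filter_upwards [self_mem_nhdsWithin] with x hx
    exact fun h => hx (ofReal_injective h)
  have hfreq : ∃ᶠ z in nhdsWithin ((-1 : ℝ) : ℂ) {((-1 : ℝ) : ℂ)}ᶜ,
      complexMGF id (powerMeasure ω) z = 1 / (-z) ^ ((ω : ℂ) + 1) := by
    refine htend.frequently (Filter.Eventually.frequently ?_)
    filter_upwards [nhdsWithin_le_nhds (Iio_mem_nhds (by norm_num : (-1 : ℝ) < 0))] with x hx
    exact hreal x hx
  have heq := han1.eqOn_of_preconnected_of_frequently_eq han2 hconn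
    (by simp : ((-1 : ℝ) : ℂ) ∈ {z : ℂ | z.re < 0}) hfreq
  have e : ∫ u in Ioi (0 : ℝ), ((u ^ ω / Real.Gamma (ω + 1) : ℝ) : ℂ) * cexp (-(s * u)) =
      1 / s ^ ((ω : ℂ) + 1) := by
    have := heq (show -s ∈ {z : ℂ | z.re < 0} by simpa using hs)
    simp only [hmgf, neg_neg] at this
    exact this
  refine ⟨Integrable.of_integral_ne_zero ?_, e⟩
  rw [e]
  have := hne (-s) (by simpa using hs)
  rw [neg_neg] at this
  exact one_div_ne_zero this

lemma ofReal_two_mul_re (c z : ℂ) :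
    ((2 * (c * z).re : ℝ) : ℂ) = c * z + (starRingEnd ℂ) c * (starRingEnd ℂ) z := by
  rw [← map_mul, add_conj]

lemma laplace_pureTerm (c : ℂ) (b : ℝ) {ω : ℝ} (hω : -1 < ω) {s : ℂ} (hs : 0 < s.re) :
    IntegrableOn (fun u : ℝ => (pureTerm c b ω u : ℂ) * cexp (-(s * u))) (Ioi 0) ∧
    ∫ u in Ioi (0 : ℝ), (pureTerm c b ω u : ℂ) * cexp (-(s * u)) =
      c / (s + I * (b : ℂ)) ^ ((ω : ℂ) + 1) +
        (starRingEnd ℂ) c / (s - I * (b : ℂ)) ^ ((ω : ℂ) + 1) := by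
  obtain ⟨i1, e1⟩ := laplace_rpow hω (s := s + I * b) (by simpa using hs)
  obtain ⟨i2, e2⟩ := laplace_rpow hω (s := s - I * b) (by simpa using hs)
  have e : ∀ u : ℝ, (pureTerm c b ω u : ℂ) * cexp (-(s * u)) =
      c * (((u ^ ω / Real.Gamma (ω + 1) : ℝ) : ℂ) * cexp (-((s + I * b) * u))) +
      (starRingEnd ℂ) c * (((u ^ ω / Real.Gamma (ω + 1) : ℝ) : ℂ) * cexp (-((s - I * b) * u))) := by
    intro u
    have a1 : cexp (-((s + I * b) * u)) = cexp (-(I * b * u)) * cexp (-(s * u)) := by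
      rw [← Complex.exp_add]; ring_nf
    have a2 : cexp (-((s - I * b) * u)) = (starRingEnd ℂ) (cexp (-(I * b * u))) * cexp (-(s * u)) := by
      rw [← Complex.exp_conj, ← Complex.exp_add]
      simp
      ring_nf
    rw [pureTerm, ofReal_mul, ofReal_two_mul_re, a1, a2]
    ring
  simp only [e]
  refine ⟨(i1.const_mul c).add (i2.const_mul _), ?_⟩
  rw [integral_add (i1.const_mul c) (i2.const_mul _), integral_const_mul, integral_const_mul, e1, e2]
  ring

/-- The normalised main term as a function of `u = log x`, extended by zero. -/
def pureMain {n : ℕ} {m : Fin (n + 1) → ℕ} (c : (k : Fin (n + 1)) → Fin (m k) → ℂ)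
    (b : Fin (n + 1) → ℝ) (ω : (k : Fin (n + 1)) → Fin (m k) → ℝ) : ℝ → ℝ :=
  (Ioi 0).indicator fun u => ∑ k, ∑ l, pureTerm (c k l) (b k) (ω k l) u

lemma pureMain_log {n : ℕ} {m : Fin (n + 1) → ℕ} (c : (k : Fin (n + 1)) → Fin (m k) → ℂ)
    (b : Fin (n + 1) → ℝ) (ω : (k : Fin (n + 1)) → Fin (m k) → ℝ) {x : ℝ} (hx : 0 < Real.log x) :
    pureMain c b ω (Real.log x) = mainTerm c b ω x :=
  indicator_of_mem (mem_Ioi.2 hx) _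

lemma pureMain_mul_damping {n : ℕ} {m : Fin (n + 1) → ℕ} (c : (k : Fin (n + 1)) → Fin (m k) → ℂ)
    (b : Fin (n + 1) → ℝ) (ω : (k : Fin (n + 1)) → Fin (m k) → ℝ) (σ u : ℝ) :
    pureMain c b ω u * damping σ u = dampedMain c b ω σ u := by
  by_cases h : u ∈ Ioi (0 : ℝ)
  · simp only [pureMain, dampedMain, indicator_of_mem h, Finset.sum_mul]
    rfl
  · simp only [pureMain, dampedMain, indicator_of_notMem h, zero_mul]

lemma laplace_pureMain {n : ℕ} {m : Fin (n + 1) → ℕ} (c : (k : Fin (n + 1)) → Fin (m k) → ℂ)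
    (b : Fin (n + 1) → ℝ) {ω : (k : Fin (n + 1)) → Fin (m k) → ℝ} (hω : ∀ k l, -1 < ω k l)
    {s : ℂ} (hs : 0 < s.re) :
    Integrable (fun u : ℝ => (pureMain c b ω u : ℂ) * cexp (-(s * u))) ∧
    ∫ u : ℝ, (pureMain c b ω u : ℂ) * cexp (-(s * u)) = singularPart c b ω s := by
  have e : (fun u : ℝ => (pureMain c b ω u : ℂ) * cexp (-(s * u))) =
      (Ioi 0).indicator fun u : ℝ => ∑ k, ∑ l, (pureTerm (c k l) (b k) (ω k l) u : ℂ) *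
        cexp (-(s * u)) := by
    ext u
    by_cases h : u ∈ Ioi (0 : ℝ)
    · simp only [pureMain, indicator_of_mem h, ofReal_sum, Finset.sum_mul]
    · simp only [pureMain, indicator_of_notMem h, ofReal_zero, zero_mul]
  have hi : ∀ k l, Integrable (fun u : ℝ => (pureTerm (c k l) (b k) (ω k l) u : ℂ) *
        cexp (-(s * u))) (volume.restrict (Ioi 0)) := fun k l =>
    (laplace_pureTerm (c k l) (b k) (hω k l) hs).1
  rw [e]
  constructor
  · rw [integrable_indicator_iff measurableSet_Ioi]
    exact integrable_finsetSum _ fun k _ => integrable_finsetSum _ fun l _ => hi k l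
  · rw [integral_indicator measurableSet_Ioi,
      integral_finsetSum _ fun k _ => integrable_finsetSum _ fun l _ => hi k l]
    refine Finset.sum_congr rfl fun k _ => ?_
    rw [integral_finsetSum _ fun l _ => hi k l]
    exact Finset.sum_congr rfl fun l _ => (laplace_pureTerm (c k l) (b k) (hω k l) hs).2

end

/-! ### Laplace transform of the counting function and Fourier transform of the damped remainder. -/

section

open Complex Set Function

lemma rightLim_eq_zero_of_lt {A : ℝ → ℝ} (h0 : ∀ x, x < 1 → A x = 0) {x : ℝ} (hx : x < 1) :
    rightLim A x = 0 := by
  refine rightLim_eq_of_tendsto ?_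
  refine Filter.Tendsto.congr' ?_ tendsto_const_nhds
  filter_upwards [nhdsWithin_le_nhds (Iio_mem_nhds hx)] with y hy
  exact (h0 y hy).symm

/-- The measure is built from the right-continuous version of A, hence the right limit; the left
limit at 1 is 0 because A vanishes below 1. -/
lemma stieltjesMeasure_real_Icc {A : ℝ → ℝ} (hA : Monotone A) (h0 : ∀ x, x < 1 → A x = 0) (x : ℝ) :
    (stieltjesMeasure A hA).real (Icc 1 x) = rightLim A x := by
  have hl : leftLim (hA.stieltjesFunction) 1 = 0 := by
    refine leftLim_eq_of_tendsto ?_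
    refine Filter.Tendsto.congr' ?_ tendsto_const_nhds
    filter_upwards [self_mem_nhdsWithin] with y hy
    rw [hA.stieltjesFunction_eq, rightLim_eq_zero_of_lt h0 hy]
  have hnn : 0 ≤ rightLim A x := by
    have : A (min x 0) ≤ rightLim A x := hA.le_rightLim (min_le_left _ _)
    rwa [h0 _ (lt_of_le_of_lt (min_le_right _ _) one_pos)] at this
  rw [measureReal_def, stieltjesMeasure, StieltjesFunction.measure_Icc, hl, sub_zero,
    hA.stieltjesFunction_eq, ENNReal.toReal_ofReal hnn]

/-- A monotone function has only countably many discontinuities, so replacing A by its right limits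
does not affect integrals in u. -/
lemma ae_rightLim_exp_eq {A : ℝ → ℝ} (hA : Monotone A) :
    ∀ᵐ u : ℝ, rightLim A (Real.exp u) = A (Real.exp u) := by
  have hc : (Real.exp ⁻¹' {x | ¬ ContinuousAt A x}).Countable :=
    hA.countable_not_continuousAt.preimage Real.exp_injective
  have := hc.measure_zero volume
  filter_upwards [compl_mem_ae_iff.2 this] with u hu
  simp only [mem_compl_iff, mem_preimage, mem_ofPred_eq, not_not] at hu
  exact hu.continuousWithinAt.rightLim_eq

lemma integral_Ici_exp_neg_mul {a : ℂ} (ha : 1 < a.re) {y : ℝ} (hy : 0 < y) :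
    IntegrableOn (fun u : ℝ => cexp (-(a * u))) (Ici (Real.log y)) ∧
    ∫ u in Ici (Real.log y), cexp (-(a * u)) = 1 / a * (y : ℂ) ^ (-a) := by
  have ha' : (-a).re < 0 := by simp; linarith
  have e : ∀ u : ℝ, cexp (-(a * u)) = cexp (-a * u) := fun u => by rw [neg_mul]
  simp only [e]
  constructor
  · rw [integrableOn_Ici_iff_integrableOn_Ioi]
    exact integrableOn_exp_mul_complex_Ioi ha' _
  · rw [integral_Ici_eq_integral_Ioi, integral_exp_mul_complex_Ioi ha',
      cpow_def_of_ne_zero (ofReal_ne_zero.2 hy.ne'), ← ofReal_log hy.le, neg_div_neg_eq,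
      mul_comm (-a)]
    ring

/-- Fubini for e^{-au} on the region y ≤ e^u, with dA(y) and du: integrating in u first gives
y^{-a}/a, integrating in y first gives the right limit of A at e^u. -/
lemma laplace_counting {A : ℝ → ℝ} (hA : Monotone A) (h0 : ∀ x, x < 1 → A x = 0)
    (hM : MellinConverges A hA) {a : ℂ} (ha : 1 < a.re) :
    Integrable (fun u : ℝ => (A (Real.exp u) : ℂ) * cexp (-(a * u))) ∧
    ∫ u : ℝ, (A (Real.exp u) : ℂ) * cexp (-(a * u)) = 1 / a * mellinStieltjes A hA a := by
  set μ := (stieltjesMeasure A hA).restrict (Ici 1) with hμ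
  have : SFinite μ := by rw [hμ, stieltjesMeasure]; infer_instance
  set Φ : ℝ × ℝ → ℂ := {z : ℝ × ℝ | z.1 ≤ Real.exp z.2}.indicator fun z => cexp (-(a * z.2)) with hΦ
  have hmeas : MeasurableSet {z : ℝ × ℝ | z.1 ≤ Real.exp z.2} :=
    measurableSet_le measurable_fst (Real.measurable_exp.comp measurable_snd)
  have hpos : ∀ᵐ y ∂μ, (0 : ℝ) < y := by
    filter_upwards [ae_restrict_mem measurableSet_Ici] with y hy
    exact lt_of_lt_of_le one_pos hy
  have hrow : ∀ y : ℝ, 0 < y → (fun u => Φ (y, u)) =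
      (Ici (Real.log y)).indicator fun u : ℝ => cexp (-(a * u)) := by
    intro y hy
    ext u
    simp only [hΦ, indicator, mem_ofPred_eq, mem_Ici, Real.log_le_iff_le_exp hy]
  have hre : (1 : ℝ) < ((a.re : ℝ) : ℂ).re := by simpa using ha
  have hnorm : ∀ y : ℝ, 0 < y → ∫ u, ‖Φ (y, u)‖ = 1 / a.re * ‖(y : ℂ) ^ (-a)‖ := by
    intro y hy
    have h1 : (fun u => ‖Φ (y, u)‖) =
        (Ici (Real.log y)).indicator fun u : ℝ => Real.exp (-(a.re * u)) := by
      ext u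
      rw [congrFun (hrow y hy) u, norm_indicator_eq_indicator_norm]
      simp [Complex.norm_exp]
    have h2 := (integral_Ici_exp_neg_mul hre hy).2
    rw [h1, integral_indicator measurableSet_Ici, norm_cpow_eq_rpow_re_of_pos hy]
    apply ofReal_injective
    rw [← integral_complex_ofReal]
    push_cast
    rw [h2, ofReal_cpow hy.le]
    simp
  have hint : Integrable Φ (μ.prod volume) := by
    rw [integrable_prod_iff]
    · constructor
      · filter_upwards [hpos] with y hy
        rw [hrow y hy, integrable_indicator_iff measurableSet_Ici]
        exact (integral_Ici_exp_neg_mul ha hy).1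
      · have : Integrable (fun y : ℝ => 1 / a.re * ‖(y : ℂ) ^ (-a)‖) μ :=
          (hM a ha).norm.const_mul _
        refine this.congr ?_
        filter_upwards [hpos] with y hy
        rw [hnorm y hy]
    · exact ((by fun_prop : Measurable fun z : ℝ × ℝ => cexp (-(a * z.2))).indicator
        hmeas).aestronglyMeasurable
  have hcol : ∀ u : ℝ, ∫ y, Φ (y, u) ∂μ = ((rightLim A (Real.exp u) : ℝ) : ℂ) * cexp (-(a * u)) := by
    intro u
    have h1 : (fun y => Φ (y, u)) = (Iic (Real.exp u)).indicator fun _ => cexp (-(a * u)) := by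
      ext y
      simp only [hΦ, indicator, mem_ofPred_eq, mem_Iic]
    rw [h1, integral_indicator_const _ measurableSet_Iic, hμ, measureReal_restrict_apply
      measurableSet_Iic, inter_comm, Ici_inter_Iic, stieltjesMeasure_real_Icc hA h0, real_smul]
  have hae : (fun u : ℝ => ∫ y, Φ (y, u) ∂μ) =ᵐ[volume]
      fun u : ℝ => (A (Real.exp u) : ℂ) * cexp (-(a * u)) := by
    filter_upwards [ae_rightLim_exp_eq hA] with u hu
    rw [hcol, hu]
  refine ⟨hint.integral_prod_right.congr hae, ?_⟩
  rw [← integral_congr_ae hae, ← integral_integral_swap (f := fun y u => Φ (y, u)) hint,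
    mellinStieltjes, ← integral_const_mul]
  refine integral_congr_ae ?_
  filter_upwards [hpos] with y hy
  rw [hrow y hy, integral_indicator measurableSet_Ici, (integral_Ici_exp_neg_mul ha hy).2]

/-- The remainder `e^{-u} A(e^u)` minus the main term. -/
def remainder (A : ℝ → ℝ) {n : ℕ} {m : Fin (n + 1) → ℕ} (c : (k : Fin (n + 1)) → Fin (m k) → ℂ)
    (b : Fin (n + 1) → ℝ) (ω : (k : Fin (n + 1)) → Fin (m k) → ℝ) (u : ℝ) : ℝ :=
  A (Real.exp u) * Real.exp (-u) - pureMain c b ω u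

lemma laplace_remainder {A : ℝ → ℝ} (hA : Monotone A) (h0 : ∀ x, x < 1 → A x = 0)
    (hM : MellinConverges A hA) {n : ℕ} {m : Fin (n + 1) → ℕ}
    (c : (k : Fin (n + 1)) → Fin (m k) → ℂ)
    (b : Fin (n + 1) → ℝ) {ω : (k : Fin (n + 1)) → Fin (m k) → ℝ} (hω : ∀ k l, -1 < ω k l)
    {s : ℂ} (hs : 0 < s.re) :
    Integrable (fun u : ℝ => (remainder A c b ω u : ℂ) * cexp (-(s * u))) ∧
    ∫ u : ℝ, (remainder A c b ω u : ℂ) * cexp (-(s * u)) = G A hA c b ω s := by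
  obtain ⟨i1, e1⟩ := laplace_counting hA h0 hM (a := s + 1) (by simpa using hs)
  obtain ⟨i2, e2⟩ := laplace_pureMain c b hω hs
  have e : ∀ u : ℝ, (remainder A c b ω u : ℂ) * cexp (-(s * u)) =
      (A (Real.exp u) : ℂ) * cexp (-((s + 1) * u)) - (pureMain c b ω u : ℂ) * cexp (-(s * u)) := by
    intro u
    have : cexp (-((s + 1) * u)) = cexp (-(u : ℂ)) * cexp (-(s * u)) := by
      rw [← Complex.exp_add]; ring_nf
    rw [remainder, this]
    push_cast
    ring
  simp only [e]
  exact ⟨i1.sub i2, by rw [integral_sub i1 i2, e1, e2, G]⟩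

lemma fourierInt_remainder {A : ℝ → ℝ} (hA : Monotone A) (h0 : ∀ x, x < 1 → A x = 0)
    (hM : MellinConverges A hA) {n : ℕ} {m : Fin (n + 1) → ℕ}
    (c : (k : Fin (n + 1)) → Fin (m k) → ℂ)
    (b : Fin (n + 1) → ℝ) {ω : (k : Fin (n + 1)) → Fin (m k) → ℝ} (hω : ∀ k l, -1 < ω k l)
    {σ : ℝ} (hσ : 0 < σ) :
    Integrable (fun u => remainder A c b ω u * damping σ u) ∧
    ∀ τ : ℝ, fourierInt (fun u => remainder A c b ω u * damping σ u) τ =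
      G A hA c b ω (σ + I * τ) - G A hA c b ω (2 * σ + I * τ) := by
  have e : ∀ τ u : ℝ, ((remainder A c b ω u * damping σ u : ℝ) : ℂ) * cexp (-(I * τ * u)) =
      (remainder A c b ω u : ℂ) * cexp (-((σ + I * τ) * u)) -
      (remainder A c b ω u : ℂ) * cexp (-((2 * σ + I * τ) * u)) := by
    intro τ u
    have a1 : cexp (-((σ + I * τ) * u)) = cexp (-(σ * u)) * cexp (-(I * τ * u)) := by
      rw [← Complex.exp_add]; ring_nf
    have a2 : cexp (-((2 * σ + I * τ) * u)) = cexp (-(2 * (σ * u))) * cexp (-(I * τ * u)) := by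
      rw [← Complex.exp_add]; ring_nf
    rw [a1, a2, damping]
    push_cast
    ring
  have l1 := fun τ : ℝ => laplace_remainder hA h0 hM c b hω (s := σ + I * τ) (by simpa using hσ)
  have l2 := fun τ : ℝ => laplace_remainder hA h0 hM c b hω (s := 2 * σ + I * τ) (by simpa using hσ)
  constructor
  -- At τ = 0 the integrand is the damped remainder itself, viewed in ℂ.
  · have h := (l1 0).1.sub (l2 0).1
    have h' := h.re
    refine h'.congr (Filter.Eventually.of_forall fun u => ?_)
    have := e 0 u
    simp only [Pi.sub_apply]
    rw [← this]
    simp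
  · intro τ
    unfold fourierInt
    simp only [e]
    rw [integral_sub (l1 τ).1 (l2 τ).1, (l1 τ).2, (l2 τ).2]

lemma fourierMass_remainder {A : ℝ → ℝ} (hA : Monotone A) (h0 : ∀ x, x < 1 → A x = 0)
    (hM : MellinConverges A hA) {n : ℕ} {m : Fin (n + 1) → ℕ}
    (c : (k : Fin (n + 1)) → Fin (m k) → ℂ)
    (b : Fin (n + 1) → ℝ) {ω : (k : Fin (n + 1)) → Fin (m k) → ℝ} (hω : ∀ k l, -1 < ω k l)
    {σ : ℝ} (hσ : 0 < σ) (T : ℝ) :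
    fourierMass (fun u => remainder A c b ω u * damping σ u) T = eta A hA c b ω σ T := by
  simp only [fourierMass, eta, (fourierInt_remainder hA h0 hM c b hω hσ).2, norm_sub_rev]

end

/-! ### Slow decrease of the damped counting function and the combined estimate. -/

section

open Set

/-- The damped normalised counting function `e^{-u} A(e^u) (e^{-σu} - e^{-2σu})`. -/
def dampedCounting (A : ℝ → ℝ) (σ u : ℝ) : ℝ :=
  A (Real.exp u) * Real.exp (-u) * damping σ u

lemma remainder_mul_damping (A : ℝ → ℝ) {n : ℕ} {m : Fin (n + 1) → ℕ}
    (c : (k : Fin (n + 1)) → Fin (m k) → ℂ)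
    (b : Fin (n + 1) → ℝ) (ω : (k : Fin (n + 1)) → Fin (m k) → ℝ) (σ u : ℝ) :
    remainder A c b ω u * damping σ u = dampedCounting A σ u - dampedMain c b ω σ u := by
  rw [remainder, sub_mul, pureMain_mul_damping, dampedCounting]

lemma dampedCounting_of_neg {A : ℝ → ℝ} (h0 : ∀ x, x < 1 → A x = 0) (σ : ℝ) {u : ℝ} (hu : u < 0) :
    dampedCounting A σ u = 0 := by
  rw [dampedCounting, h0 _ (by rwa [← Real.exp_zero, Real.exp_lt_exp]), zero_mul, zero_mul]

lemma damping_nonneg {σ u : ℝ} (hσ : 0 ≤ σ) (hu : 0 ≤ u) : 0 ≤ damping σ u :=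
  exp_neg_sub_exp_neg_two_mul_nonneg (mul_nonneg hσ hu)

lemma dampedCounting_nonneg {A : ℝ → ℝ} (hA0 : ∀ x, 0 ≤ A x) (h0 : ∀ x, x < 1 → A x = 0)
    {σ : ℝ} (hσ : 0 ≤ σ) (u : ℝ) : 0 ≤ dampedCounting A σ u := by
  rcases lt_or_ge u 0 with hu | hu
  · exact (dampedCounting_of_neg h0 σ hu).ge
  · exact mul_nonneg (mul_nonneg (hA0 _) (Real.exp_pos _).le) (damping_nonneg hσ hu)

/-- The damped counting function times `e^{2u}` is nondecreasing. -/
lemma dampedCounting_slow {A : ℝ → ℝ} (hA : Monotone A) (hA0 : ∀ x, 0 ≤ A x)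
    (h0 : ∀ x, x < 1 → A x = 0) {σ : ℝ} (hσ : 0 ≤ σ) (hσ1 : σ ≤ 1) (u : ℝ) {v : ℝ} (hv : 0 ≤ v) :
    dampedCounting A σ u * Real.exp (-(2 * v)) ≤ dampedCounting A σ (u + v) := by
  rcases lt_or_ge u 0 with hu | hu
  · rw [dampedCounting_of_neg h0 σ hu, zero_mul]
    exact dampedCounting_nonneg hA0 h0 hσ _
  · have h1 : A (Real.exp u) ≤ A (Real.exp (u + v)) := hA (Real.exp_le_exp.2 (by linarith))
    -- In e^{-σu}(1 - e^{-σu}) the second factor increases with u, and the first loses only e^{-σv}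
    -- ≥ e^{-v} because σ ≤ 1. The other factor e^{-v} of the claim comes from e^{-u}.
    have h2 : damping σ u * Real.exp (-v) ≤ damping σ (u + v) := by
      have e1 : Real.exp (-v) ≤ Real.exp (-(σ * v)) := Real.exp_le_exp.2 (by nlinarith)
      have e2 : Real.exp (-(σ * (u + v))) = Real.exp (-(σ * u)) * Real.exp (-(σ * v)) := by
        rw [← Real.exp_add]; ring_nf
      have e3 : Real.exp (-(σ * (u + v))) ≤ Real.exp (-(σ * u)) :=
        Real.exp_le_exp.2 (by nlinarith)
      have e4 : Real.exp (-(σ * u)) ≤ 1 := Real.exp_le_one_iff.2 (by nlinarith)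
      rw [damping, damping, exp_neg_sub_exp_neg_two_mul, exp_neg_sub_exp_neg_two_mul]
      calc Real.exp (-(σ * u)) * (1 - Real.exp (-(σ * u))) * Real.exp (-v)
          = Real.exp (-(σ * u)) * Real.exp (-v) * (1 - Real.exp (-(σ * u))) := by ring
        _ ≤ Real.exp (-(σ * u)) * Real.exp (-(σ * v)) * (1 - Real.exp (-(σ * (u + v)))) := by
            refine mul_le_mul ?_ (by linarith) (by linarith) (by positivity)
            exact mul_le_mul_of_nonneg_left e1 (Real.exp_pos _).le
        _ = _ := by rw [← e2]
    have e5 : Real.exp (-(u + v)) = Real.exp (-u) * Real.exp (-v) := by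
      rw [← Real.exp_add]; ring_nf
    have e6 : Real.exp (-(2 * v)) = Real.exp (-v) * Real.exp (-v) := by
      rw [← Real.exp_add]; ring_nf
    calc dampedCounting A σ u * Real.exp (-(2 * v))
        = A (Real.exp u) * Real.exp (-(u + v)) * (damping σ u * Real.exp (-v)) := by
          rw [dampedCounting, e5, e6]; ring
      _ ≤ A (Real.exp (u + v)) * Real.exp (-(u + v)) * damping σ (u + v) := by
          refine mul_le_mul ?_ h2 (mul_nonneg (damping_nonneg hσ hu) (Real.exp_pos _).le)
            (mul_nonneg (hA0 _) (Real.exp_pos _).le)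
          exact mul_le_mul_of_nonneg_right h1 (Real.exp_pos _).le

lemma fourierMass_comp_add_div (g : ℝ → ℝ) (u : ℝ) {T : ℝ} (hT : 0 < T) :
    fourierMass (fun y => g (y / T + u)) 1 = fourierMass g T := by
  rw [fourierMass_comp_div (fun y => g (y + u)) hT, fourierMass_comp_add]

/-- Tauberian estimate for the difference of a nonnegative function `F` with `F(u) e^{2u}`
nondecreasing and a bounded function `N` that is Lipschitz at `u₀`: a crude bound for `F`, and a
bound for `F - N` at `u₀`. -/
lemma exists_slow_bound : ∃ C : ℝ, 0 ≤ C ∧ ∀ (F N : ℝ → ℝ) (L u₀ T : ℝ), 0 ≤ L → 0 < T →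
    Integrable (fun u => F u - N u) → (∀ u, 0 ≤ F u) →
    (∀ u v, 0 ≤ v → F u * Real.exp (-(2 * v)) ≤ F (u + v)) → (∀ u, |N u| ≤ L) →
    (∀ u, |N u - N u₀| ≤ L * |u - u₀|) →
    |F u₀ - N u₀| ≤ C * (Real.exp (2 / T) * (fourierMass (fun u => F u - N u) T + L)) ∧
    (1 ≤ T → |F u₀ - N u₀| ≤ C * (fourierMass (fun u => F u - N u) T + L / T)) := by
  obtain ⟨C₁, hC₁, crude⟩ := exists_crude_bound
  obtain ⟨C₂, hC₂, taub⟩ := exists_tauberian_bound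
  refine ⟨(C₁ + 1) + C₂ * (1 + 2 * (Real.exp 2 * C₁) + 1), by positivity,
    fun F N L u₀ T hL hT hg hF hslow hN hLip => ?_⟩
  set g : ℝ → ℝ := fun u => F u - N u with hgdef
  set W := fourierMass g T with hW
  have hW0 : 0 ≤ W := intervalIntegral.integral_nonneg (by linarith) fun _ _ => norm_nonneg _
  have hint : ∀ u, Integrable fun y => g (y / T + u) := fun u =>
    (hg.comp_add_right u).comp_div hT.ne'
  have hFQ : ∀ u, F u ≤ Real.exp (2 / T) * (C₁ * (W + L)) := by
    intro u
    -- On [u, u + 1/T], the rescaled unit interval, F stays above F(u)e^{-2/T}; adding L to F - N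
    -- makes it at least F.
    have h := crude (fun y => g (y / T + u)) (F u * Real.exp (-(2 * (1 / T)))) L (hint u)
      (mul_nonneg (hF u) (Real.exp_pos _).le) hL ?_ ?_
    · rw [fourierMass_comp_add_div g u hT, ← hW] at h
      calc F u = Real.exp (2 / T) * (F u * Real.exp (-(2 * (1 / T)))) := by
            rw [mul_left_comm, ← Real.exp_add]
            have : 2 / T + -(2 * (1 / T)) = 0 := by ring
            rw [this, Real.exp_zero, mul_one]
        _ ≤ _ := mul_le_mul_of_nonneg_left h (Real.exp_pos _).le
    · intro y
      simp only [hgdef]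
      linarith [hF (y / T + u), (abs_le.1 (hN (y / T + u))).2]
    · intro y hy0 hy1
      have h1 := hslow u (y / T) (by positivity)
      have h2 : Real.exp (-(2 * (1 / T))) ≤ Real.exp (-(2 * (y / T))) := by
        rw [Real.exp_le_exp, neg_le_neg_iff]
        gcongr
      have h3 := mul_le_mul_of_nonneg_left h2 (hF u)
      rw [add_comm u] at h1
      simp only [hgdef]
      linarith [(abs_le.1 (hN (y / T + u))).2]
  have hE2 : 1 ≤ Real.exp (2 / T) := Real.one_le_exp (by positivity)
  have hK : 0 ≤ C₂ * (1 + 2 * (Real.exp 2 * C₁) + 1) := by positivity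
  constructor
  · have h1 : |F u₀ - N u₀| ≤ F u₀ + L := by
      refine (abs_sub _ _).trans ?_
      rw [abs_of_nonneg (hF u₀)]
      linarith [hN u₀]
    calc |F u₀ - N u₀| ≤ Real.exp (2 / T) * (C₁ * (W + L)) + Real.exp (2 / T) * (W + L) := by
          have : L ≤ Real.exp (2 / T) * (W + L) := by nlinarith
          linarith [hFQ u₀]
      _ = (C₁ + 1) * (Real.exp (2 / T) * (W + L)) := by ring
      _ ≤ _ := mul_le_mul_of_nonneg_right (by linarith) (by positivity)
  · intro hT1
    set Q := Real.exp 2 * (C₁ * (W + L)) with hQ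
    have hQ0 : 0 ≤ Q := by positivity
    have hFQ' : ∀ u, F u ≤ Q := by
      intro u
      refine (hFQ u).trans (mul_le_mul_of_nonneg_right ?_ (by positivity))
      rw [Real.exp_le_exp]
      exact div_le_self (by norm_num) hT1
    -- The crude bound F ≤ Q converts the multiplicative slow decrease into an additive one, through
    -- e^{-2v} ≥ 1 - 2v.
    have hstep : ∀ u v, 0 ≤ v → F u ≤ F (u + v) + 2 * Q * v := by
      intro u v hv
      have h1 := hslow u v hv
      have h2 := Real.add_one_le_exp (-(2 * v))
      nlinarith [hF u, hFQ' u, mul_nonneg (hF u) hv, mul_le_mul_of_nonneg_left h2 (hF u),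
        mul_le_mul_of_nonneg_right (hFQ' u) hv]
    have hloc : ∀ v, -((2 * Q + L) * v ^ 2) ≤ v * (g (v + u₀) - g u₀) := by
      intro v
      have hn := abs_le.1 (hLip (v + u₀))
      rw [add_sub_cancel_right] at hn
      simp only [hgdef]
      rcases le_total 0 v with hv | hv
      · rw [abs_of_nonneg hv] at hn
        have h1 := hstep u₀ v hv
        rw [add_comm u₀] at h1
        have : -((2 * Q + L) * v) ≤ F (v + u₀) - N (v + u₀) - (F u₀ - N u₀) := by linarith [hn.2]
        nlinarith [mul_le_mul_of_nonneg_left this hv]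
      · rw [abs_of_nonpos hv] at hn
        have h1 := hstep (v + u₀) (-v) (by linarith)
        rw [add_neg_cancel_comm] at h1
        have : F (v + u₀) - N (v + u₀) - (F u₀ - N u₀) ≤ -((2 * Q + L) * v) := by linarith [hn.1]
        nlinarith [mul_le_mul_of_nonpos_left this hv]
    -- Stretching by T divides the one-sided Lipschitz constant by T: this is the source of the gain
    -- 1/T.
    have h := taub (fun y => g (y / T + u₀)) ((2 * Q + L) / T) (hint u₀) (by positivity) ?_
    · rw [fourierMass_comp_add_div g u₀ hT, ← hW] at h
      simp only [zero_div, zero_add] at h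
      have hP : (2 * Q + L) / T ≤ 2 * (Real.exp 2 * C₁) * (W + L / T) + L / T := by
        have e : (2 * Q + L) / T = 2 * (Real.exp 2 * C₁) * (W / T + L / T) + L / T := by
          rw [hQ]; ring
        rw [e]
        -- Q contains W itself; since T ≥ 1, its share W/T is absorbed into the Fourier mass.
        have : W / T ≤ W := div_le_self hW0 hT1
        gcongr
      have hLT : 0 ≤ L / T := by positivity
      calc |F u₀ - N u₀| ≤ C₂ * (W + (2 * Q + L) / T) := h
        _ ≤ C₂ * (W + (2 * (Real.exp 2 * C₁) * (W + L / T) + L / T)) := by gcongr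
        _ = C₂ * (1 + 2 * (Real.exp 2 * C₁)) * (W + L / T) := by ring
        _ ≤ _ := by
          refine mul_le_mul_of_nonneg_right ?_ (by positivity)
          nlinarith
    · intro y
      have h1 := mul_le_mul_of_nonneg_left (hloc (y / T)) hT.le
      simp only [zero_div, zero_add]
      have e1 : T * (y / T * (g (y / T + u₀) - g u₀)) = y * (g (y / T + u₀) - g u₀) := by
        field_simp
      have e2 : T * -((2 * Q + L) * (y / T) ^ 2) = -((2 * Q + L) / T * y ^ 2) := by
        field_simp
      rw [e1, e2] at h1
      exact h1

/-- Sharper than the theorem needs: the last summand of ρ_T is absent, and log x ≥ 1 is the only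
lower bound on x beyond positivity. -/
lemma exists_counting_bound {n : ℕ} {m : Fin (n + 1) → ℕ}
    (c : (k : Fin (n + 1)) → Fin (m k) → ℂ) (b : Fin (n + 1) → ℝ) (Ω : ℝ) :
    ∃ C : ℝ, 0 ≤ C ∧ ∀ ω : (k : Fin (n + 1)) → Fin (m k) → ℝ, (∀ k l, -1 < ω k l) →
      (∀ k l, ω k l ≤ Ω) → ∀ (A : ℝ → ℝ) (hA : Monotone A), (∀ x, 0 ≤ A x) →
      (∀ x, x < 1 → A x = 0) → MellinConverges A hA → ∀ T : ℝ, 0 < T → ∀ x : ℝ, 0 < x →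
      1 ≤ Real.log x →
      |A x - x * mainTerm c b ω x| ≤ C * (x *
        (Real.exp (2 / T) * (eta A hA c b ω (1 / Real.log x) T + Real.log x ^ Ω))) ∧
      (1 ≤ T → |A x - x * mainTerm c b ω x| ≤ C * (x *
        (eta A hA c b ω (1 / Real.log x) T + Real.log x ^ Ω / T))) := by
  obtain ⟨K, hK, hmain⟩ := exists_dampedMain_bound c b Ω
  obtain ⟨C, hC, hslow⟩ := exists_slow_bound
  set w := Real.exp (-1) - Real.exp (-(2 * 1)) with hw
  have hw0 : 0 < w := by
    rw [hw, sub_pos, Real.exp_lt_exp]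
    norm_num
  refine ⟨C * (1 + K) / w, by positivity, fun ω hω1 hω2 A hA hA0 h0 hM T hT x hx hlog => ?_⟩
  set u₀ := Real.log x with hu₀
  have hu₀' : 0 < u₀ := by linarith
  have hσ : 0 < 1 / u₀ := by positivity
  have hσ1 : 1 / u₀ ≤ 1 := by rw [div_le_one hu₀']; exact hlog
  have hU : 0 ≤ u₀ ^ Ω := by positivity
  have hg : (fun u => remainder A c b ω u * damping (1 / u₀) u) =
      fun u => dampedCounting A (1 / u₀) u - dampedMain c b ω (1 / u₀) u :=
    funext fun u => remainder_mul_damping A c b ω _ u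
  have hint := (fourierInt_remainder hA h0 hM c b hω1 hσ).1
  have hmass := fourierMass_remainder hA h0 hM c b hω1 hσ T
  rw [hg] at hint hmass
  have key := hslow (dampedCounting A (1 / u₀)) (dampedMain c b ω (1 / u₀)) (K * u₀ ^ Ω) u₀ T
    (by positivity) hT hint (dampedCounting_nonneg hA0 h0 hσ.le)
    (fun u v hv => dampedCounting_slow hA hA0 h0 hσ.le hσ1 u hv)
    (fun u => (hmain ω hω1 hω2 u₀ u hlog).1) (fun u => (hmain ω hω1 hω2 u₀ u hlog).2)
  rw [hmass] at key
  set η := eta A hA c b ω (1 / u₀) T with hη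
  have hη0 : 0 ≤ η := intervalIntegral.integral_nonneg (by linarith) fun _ _ => norm_nonneg _
  have hval : |A x - x * mainTerm c b ω x| =
      x * (|dampedCounting A (1 / u₀) u₀ - dampedMain c b ω (1 / u₀) u₀| / w) := by
    -- Since σu₀ = 1, the damping at u₀ is an absolute positive constant and can be divided out.
    have hd : damping (1 / u₀) u₀ = w := by
      rw [damping, one_div_mul_cancel hu₀'.ne']
    rw [← remainder_mul_damping, hd, abs_mul, abs_of_pos hw0, mul_div_cancel_right₀ _ hw0.ne',
      remainder, pureMain_log c b ω hu₀', hu₀, Real.exp_neg, Real.exp_log hx]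
    have : A x - x * mainTerm c b ω x = x * (A x * x⁻¹ - mainTerm c b ω x) := by field_simp
    rw [this, abs_mul, abs_of_pos hx]
  have scale : ∀ {X Y : ℝ}, 0 ≤ Y → 0 ≤ X →
      |dampedCounting A (1 / u₀) u₀ - dampedMain c b ω (1 / u₀) u₀| ≤ C * (X + K * Y) →
      |A x - x * mainTerm c b ω x| ≤ C * (1 + K) / w * (x * (X + Y)) := by
    intro X Y hY hX h
    rw [hval]
    calc _ ≤ x * (C * (X + K * Y) / w) := by gcongr
      _ ≤ x * (C * ((1 + K) * (X + Y)) / w) := by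
          gcongr
          nlinarith [mul_nonneg hK hX]
      _ = _ := by ring
  constructor
  · rw [mul_add (Real.exp (2 / T))]
    refine scale (by positivity) (by positivity) (key.1.trans_eq ?_)
    ring
  · intro hT1
    refine scale (by positivity) hη0 ((key.2 hT1).trans_eq ?_)
    ring

end

end WienerIkehara

end

/-! ### Deduction of the stated error terms. -/

theorem mainTheorem4
    (n : ℕ) (m : Fin (n + 1) → ℕ) (hm : ∀ k, 0 < m k)
    (c : (k : Fin (n + 1)) → Fin (m k) → ℂ)
    (b : Fin (n + 1) → ℝ) (hb0 : b 0 = 0) (hb : ∀ k, k ≠ 0 → 0 < b k)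
    (Ω : ℝ) :
    -- the implied constant depends only on the `c_{k,l}`, the `b_k` and `Ω`
    ∃ C : ℝ, ∀ (ω : (k : Fin (n + 1)) → Fin (m k) → ℝ) (ωmin : ℝ),
      (∀ k l, -1 < ω k l) →
      IsGreatest (Set.range fun p : (k : Fin (n + 1)) × Fin (m k) => ω p.1 p.2) Ω →
      IsLeast (Set.range fun p : (k : Fin (n + 1)) × Fin (m k) => ω p.1 p.2) ωmin →
      ∀ (A : ℝ → ℝ) (hA : Monotone A), (∀ x, 0 ≤ A x) → (∀ x, x < 1 → A x = 0) →
      WienerIkehara.MellinConverges A hA →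
      ∀ T : ℝ, 0 < T → ∀ x : ℝ, WienerIkehara.x₀ T ≤ x →
        |A x - x * WienerIkehara.mainTerm c b ω x| ≤
          C * (x *
            ((Real.exp (10 / T) / T + 1) *
                WienerIkehara.eta A hA c b ω (1 / Real.log x) T +
              Real.exp (10 / T) / T * Real.log x ^ Ω +
              1 / Real.log x * (1 / T ^ (Ω + 1) + 1 / T ^ (ωmin + 1)))) ∧
        (1 ≤ T →
          |A x - x * WienerIkehara.mainTerm c b ω x| ≤
            C * (x *
              (WienerIkehara.eta A hA c b ω (1 / Real.log x) T +
                Real.log x ^ Ω / T +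
                1 / (Real.log x * T ^ (1 + ωmin))))) := by
  obtain ⟨C, hC, hbound⟩ := WienerIkehara.exists_counting_bound c b Ω
  refine ⟨C, fun ω ωmin hω hΩ hmin A hA hA0 h0 hM T hT x hx => ?_⟩
  have hxe : Real.exp (16 / 15) ≤ x := (le_max_left _ _).trans hx
  have hx0 : 0 < x := (Real.exp_pos _).trans_le hxe
  have hlog : 1 ≤ Real.log x := by
    have := (Real.le_log_iff_exp_le hx0).2 hxe
    linarith
  have hω2 : ∀ k l, ω k l ≤ Ω := fun k l => hΩ.2 ⟨⟨k, l⟩, rfl⟩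
  obtain ⟨h1, h2⟩ := hbound ω hω hω2 A hA hA0 h0 hM T hT x hx0 hlog
  set η := WienerIkehara.eta A hA c b ω (1 / Real.log x) T with hη
  set U := Real.log x ^ Ω with hU
  have hη0 : 0 ≤ η := intervalIntegral.integral_nonneg (by linarith) fun _ _ => norm_nonneg _
  have hlog0 : 0 < Real.log x := by linarith
  have hU0 : 0 ≤ U := by positivity
  have hr1 : 0 ≤ 1 / Real.log x * (1 / T ^ (Ω + 1) + 1 / T ^ (ωmin + 1)) := by positivity
  have hr2 : 0 ≤ 1 / (Real.log x * T ^ (1 + ωmin)) := by positivity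
  refine ⟨?_, fun hT1 => (h2 hT1).trans ?_⟩
  -- For T ≥ 1 the sharp bound already implies the first estimate. For T ≤ 1 the crude factor
  -- e^{2/T} is at most e^{10/T}/T.
  · rcases le_total 1 T with hT1 | hT1
    · refine (h2 hT1).trans ?_
      have hE : 1 ≤ Real.exp (10 / T) := Real.one_le_exp (by positivity)
      have e1 : U / T ≤ Real.exp (10 / T) / T * U := by
        rw [div_mul_eq_mul_div]
        gcongr
        nlinarith
      have e2 : 0 ≤ Real.exp (10 / T) / T * η := by positivity
      refine mul_le_mul_of_nonneg_left (mul_le_mul_of_nonneg_left ?_ hx0.le) hC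
      linarith
    · refine h1.trans ?_
      have hE : Real.exp (2 / T) ≤ Real.exp (10 / T) / T := by
        rw [le_div_iff₀ hT]
        calc Real.exp (2 / T) * T ≤ Real.exp (2 / T) * 1 := by gcongr
          _ = Real.exp (2 / T) := mul_one _
          _ ≤ Real.exp (10 / T) := by
            rw [Real.exp_le_exp]
            gcongr
            norm_num
      have e1 := mul_le_mul_of_nonneg_right hE hη0
      have e2 := mul_le_mul_of_nonneg_right hE hU0
      refine mul_le_mul_of_nonneg_left (mul_le_mul_of_nonneg_left ?_ hx0.le) hC
      linarith
  · refine mul_le_mul_of_nonneg_left (mul_le_mul_of_nonneg_left ?_ hx0.le) hC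
    linarith
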